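/- For an integer $g\ge 1$ let $\Gamma_g^J=SL(2,\mathbb Z)\ltimes(\mathbb Z^g\times\mathbb Z^g)$ be the Jacobi group of degree $g$, with the law $(M,X)(M',X')=(MM',XM'+X')$. For $k\in\mathbb Z$ and a symmetric, positive definite, half-integral $g\times g$ matrix $m$ (that is, $m_{ii}\in\mathbb Z$ and $2m_{ij}\in\mathbb Z$), let $\gamma=\left(\left(\begin{smallmatrix}a&b\\c&d\end{smallmatrix}\right),(\lambda,\mu)\right)\in\Gamma_g^J$ act on functions $\phi:\mathcal H\times\mathbb C^g\to\mathbb C$ by $$(\phi|_{k,m}\gamma)(\tau,z)=(c\tau+d)^{-k}\,e\!\left(-\tfrac{c}{c\tau+d}\,m[z+\lambda\tau+\mu]+m[\lambda]\tau+2\lambda^t m z\right)\phi\!\left(\tfrac{a\tau+b}{c\tau+d},\tfrac{z+\lambda\tau+\mu}{c\tau+d}\right),$$ where $e(w)=e^{2\pi i w}$, $m[x]=x^tmx$ and $\mathcal H$ is the upper half plane. For $n\in\mathbb N$ and a row vector $r\in\mathbb Z^g$ with $4n>m^{-1}[r^t]$ define the Jacobi Poincaré series (convergent for $k>g+2$)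 by $$P^{k,m}_{n,r}(\tau,z)=\sum_{\gamma\in\Gamma^J_{g,\infty}\backslash\Gamma^J_g}\bigl(e(n\tau+rz)|_{k,m}\gamma\bigr)(\tau,z),\qquad \Gamma^J_{g,\infty}=\left\{\left(\left(\begin{smallmatrix}1&b\\0&1\end{smallmatrix}\right),(0,\mu)\right): b\in\mathbb Z,\ \mu\in\mathbb Z^g\right\}.$$ Put $D=\det\left(\begin{smallmatrix}2n&r\\r^t&2m\end{smallmatrix}\right)$, $k'=k-g/2-1$, and $\alpha(g)=\frac{2}{3(g+2)}$ for $1\le g\le 4$, $\alpha(g)=\frac{2}{3g}$ for $g\ge 5$. **Theorem.** There is an absolute constant $B>3\log 2$ such that for every $g\ge1$ there is an integer $k_0$, depending only on $g$, with the following property. Let $k\ge k_0$ be an integer, let $m$ be a symmetric, positive definite, half-integral $g\times g$ matrix, and let $n\in\mathbb N$, $r\in\mathbb Z^g$ with $4n>m^{-1}[r^t]$. Suppose that $k$ is even in case $2r\in\mathbb Z^g\cdot 2m$. If $$k'\le\frac{\pi D}{\det(2m)}\le k'^{\,1+\alpha(g)}\exp\left(-\frac{B\log k'}{\log\log k'}\right),$$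 then $P^{k,m}_{n,r}$ is not identically zero. -/

import Mathlib

open scoped UpperHalfPlane MatrixGroups

/-- The Jacobi group `SL(2, ℤ) ⋉ (ℤ^g × ℤ^g)` of degree `g`; its elements are written
`(M, (lam, mu))`. -/
@[ext]
structure JacobiGroup (g : ℕ) where
  /-- the component in `SL(2, ℤ)` -/
  M : SL(2, ℤ)
  /-- the first component of the lattice part -/
  lam : Fin g → ℤ
  /-- the second component of the lattice part -/
  mu : Fin g → ℤ

namespace JacobiGroup

variable {g : ℕ}

/-- The group law is `(M, X) (M', X') = (M M', X M' + X')`, where `X = (lam, mu)` is a row. -/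
instance : Mul (JacobiGroup g) where
  mul γ δ :=
    { M := γ.M * δ.M
      lam := δ.M 0 0 • γ.lam + δ.M 1 0 • γ.mu + δ.lam
      mu := δ.M 0 1 • γ.lam + δ.M 1 1 • γ.mu + δ.mu }

instance : One (JacobiGroup g) where
  one := { M := 1, lam := 0, mu := 0 }

instance : Inv (JacobiGroup g) where
  inv γ :=
    { M := γ.M⁻¹
      lam := -(γ.M⁻¹ 0 0 • γ.lam + γ.M⁻¹ 1 0 • γ.mu)
      mu := -(γ.M⁻¹ 0 1 • γ.lam + γ.M⁻¹ 1 1 • γ.mu) }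

theorem mul_M (γ δ : JacobiGroup g) : (γ * δ).M = γ.M * δ.M := rfl

theorem mul_lam (γ δ : JacobiGroup g) :
    (γ * δ).lam = δ.M 0 0 • γ.lam + δ.M 1 0 • γ.mu + δ.lam := rfl

theorem mul_mu (γ δ : JacobiGroup g) :
    (γ * δ).mu = δ.M 0 1 • γ.lam + δ.M 1 1 • γ.mu + δ.mu := rfl

theorem one_M : (1 : JacobiGroup g).M = 1 := rfl

theorem one_lam : (1 : JacobiGroup g).lam = 0 := rfl

theorem one_mu : (1 : JacobiGroup g).mu = 0 := rfl

theorem inv_M (γ : JacobiGroup g) : γ⁻¹.M = γ.M⁻¹ := rfl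

theorem inv_lam (γ : JacobiGroup g) :
    γ⁻¹.lam = -(γ.M⁻¹ 0 0 • γ.lam + γ.M⁻¹ 1 0 • γ.mu) := rfl

theorem inv_mu (γ : JacobiGroup g) :
    γ⁻¹.mu = -(γ.M⁻¹ 0 1 • γ.lam + γ.M⁻¹ 1 1 • γ.mu) := rfl

instance : Group (JacobiGroup g) :=
  Group.ofLeftAxioms
    (by
      intro a b c
      ext i
      · simp [mul_M, mul_assoc]
      · simp [mul_M, mul_lam, mul_mu, Matrix.mul_apply, Fin.sum_univ_two]
        ring
      · simp [mul_M, mul_lam, mul_mu, Matrix.mul_apply, Fin.sum_univ_two]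
        ring)
    (by
      intro a
      ext i
      · simp [mul_M, one_M]
      · simp [mul_lam, one_lam, one_mu]
      · simp [mul_mu, one_lam, one_mu])
    (by
      intro a
      have hdet := a.M.det_coe
      rw [Matrix.det_fin_two] at hdet
      ext i
      · simp [mul_M, inv_M, one_M]
      · simp [mul_lam, inv_lam, inv_mu, one_lam, Matrix.adjugate_fin_two]
        linear_combination (-(a.lam i)) * hdet
      · simp [mul_mu, inv_lam, inv_mu, one_mu, Matrix.adjugate_fin_two]
        linear_combination (-(a.mu i)) * hdet)

/-- The subgroup of all `((1, b; 0, 1), (0, mu))` with `b ∈ ℤ` and `mu ∈ ℤ^g`. -/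
def stabInfty (g : ℕ) : Subgroup (JacobiGroup g) where
  carrier := {γ | γ.M 0 0 = 1 ∧ γ.M 1 0 = 0 ∧ γ.M 1 1 = 1 ∧ γ.lam = 0}
  mul_mem' := by
    rintro a b ⟨h1, h2, h3, h4⟩ ⟨h5, h6, h7, h8⟩
    simp [mul_M, mul_lam, Matrix.mul_apply, Fin.sum_univ_two, *]
  one_mem' := by simp [one_M, one_lam]
  inv_mem' := by
    rintro a ⟨h1, h2, h3, h4⟩
    simp [inv_M, inv_lam, Matrix.adjugate_fin_two, *]

end JacobiGroup

noncomputable section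

/-- `m` is symmetric and half-integral: `m i i ∈ ℤ` and `2 * m i j ∈ ℤ`. -/
structure IsHalfIntegral {g : ℕ} (m : Matrix (Fin g) (Fin g) ℝ) : Prop where
  isSymm : m.IsSymm
  diag : ∀ i, ∃ a : ℤ, m i i = a
  offDiag : ∀ i j, ∃ a : ℤ, 2 * m i j = a

/-- The bilinear form `xᵗ m y` on `ℂ^g`; thus `m[x]` is `jacobiBilin m x x`. -/
def jacobiBilin {g : ℕ} (m : Matrix (Fin g) (Fin g) ℝ) (x y : Fin g → ℂ) : ℂ :=
  ∑ i, ∑ j, x i * (m i j : ℂ) * y j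

/-- `e(w) = exp(2πi w)`. -/
def expTwoPiI (w : ℂ) : ℂ := Complex.exp (2 * Real.pi * Complex.I * w)

/-- The weight `k`, index `m` action of the Jacobi group on functions on `ℍ × ℂ^g`:
for `γ = ((a, b; c, d), (lam, mu))`, `(φ|γ)(τ, z)` is
`(cτ+d)^(-k) e(-c (cτ+d)⁻¹ m[z + lam τ + mu] + m[lam] τ + 2 lamᵗ m z)`
times `φ((aτ+b)/(cτ+d), (z + lam τ + mu)/(cτ+d))`. -/
def jacobiSlash {g : ℕ} (k : ℤ) (m : Matrix (Fin g) (Fin g) ℝ)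
    (φ : ℍ → (Fin g → ℂ) → ℂ) (γ : JacobiGroup g) (τ : ℍ) (z : Fin g → ℂ) : ℂ :=
  let c : ℂ := (γ.M 1 0 : ℤ)
  let d : ℂ := (γ.M 1 1 : ℤ)
  let lam : Fin g → ℂ := fun i => (γ.lam i : ℂ)
  let w : Fin g → ℂ := fun i => z i + (γ.lam i : ℂ) * (τ : ℂ) + (γ.mu i : ℂ)
  (c * τ + d) ^ (-k) *
    expTwoPiI (-c * (c * τ + d)⁻¹ * jacobiBilin m w w + jacobiBilin m lam lam * τ
      + 2 * jacobiBilin m lam z) *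
    φ (γ.M • τ) (fun i => (c * τ + d)⁻¹ * w i)

/-- The function `e(nτ + rz)` on `ℍ × ℂ^g`. -/
def jacobiExp {g : ℕ} (n : ℕ) (r : Fin g → ℤ) (τ : ℍ) (z : Fin g → ℂ) : ℂ :=
  expTwoPiI ((n : ℂ) * τ + ∑ i, (r i : ℂ) * z i)

/-- The Jacobi Poincaré series of exponential type, of weight `k` and index `m`: the sum of
`e(nτ + rz)|γ` over the right cosets `Γ_∞ γ` of the Jacobi group. The summand does not depend on
the representative of the coset (`jacobiSlash_stabInfty_mul`). -/
def jacobiPoincare {g : ℕ} (k : ℤ) (m : Matrix (Fin g) (Fin g) ℝ) (n : ℕ) (r : Fin g → ℤ)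
    (τ : ℍ) (z : Fin g → ℂ) : ℂ :=
  ∑' q : Quotient (QuotientGroup.rightRel (JacobiGroup.stabInfty g)),
    jacobiSlash k m (jacobiExp n r) q.out τ z

/-- `D = det (2n, r; rᵗ, 2m)`. -/
def jacobiDisc {g : ℕ} (m : Matrix (Fin g) (Fin g) ℝ) (n : ℕ) (r : Fin g → ℤ) : ℝ :=
  (Matrix.fromBlocks (Matrix.of fun _ _ : Fin 1 => 2 * (n : ℝ))
    (Matrix.of fun (_ : Fin 1) j => (r j : ℝ))
    (Matrix.of fun i (_ : Fin 1) => (r i : ℝ)) ((2 : ℝ) • m)).det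

/-- The exponent `α(g)`. -/
def jacobiAlpha (g : ℕ) : ℝ :=
  if g ≤ 4 then 2 / (3 * ((g : ℝ) + 2)) else 2 / (3 * (g : ℝ))

theorem expTwoPiI_add_int (w : ℂ) (a : ℤ) : expTwoPiI (w + a) = expTwoPiI w := by
  unfold expTwoPiI
  have : 2 * (Real.pi : ℂ) * Complex.I * (w + a)
      = 2 * Real.pi * Complex.I * w + a * (2 * Real.pi * Complex.I) := by ring
  rw [this, Complex.exp_add, Complex.exp_int_mul_two_pi_mul_I, mul_one]

section Invariance

variable {g : ℕ} {m : Matrix (Fin g) (Fin g) ℝ}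

theorem jacobiBilin_add_left (x x' y : Fin g → ℂ) :
    jacobiBilin m (x + x') y = jacobiBilin m x y + jacobiBilin m x' y := by
  simp [jacobiBilin, add_mul, Finset.sum_add_distrib]

theorem jacobiBilin_add_right (x y y' : Fin g → ℂ) :
    jacobiBilin m x (y + y') = jacobiBilin m x y + jacobiBilin m x y' := by
  simp [jacobiBilin, mul_add, Finset.sum_add_distrib]

theorem jacobiBilin_smul_left (t : ℂ) (x y : Fin g → ℂ) :
    jacobiBilin m (t • x) y = t * jacobiBilin m x y := by
  simp [jacobiBilin, Finset.mul_sum, mul_assoc]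

theorem jacobiBilin_smul_right (t : ℂ) (x y : Fin g → ℂ) :
    jacobiBilin m x (t • y) = t * jacobiBilin m x y := by
  simp [jacobiBilin, Finset.mul_sum, mul_left_comm]

theorem jacobiBilin_comm (hm : IsHalfIntegral m) (x y : Fin g → ℂ) :
    jacobiBilin m x y = jacobiBilin m y x := by
  unfold jacobiBilin
  rw [Finset.sum_comm]
  refine Finset.sum_congr rfl fun i _ => Finset.sum_congr rfl fun j _ => ?_
  rw [hm.isSymm.apply i j]
  ring

theorem two_mul_jacobiBilin_int (hm : IsHalfIntegral m) (u v : Fin g → ℤ) :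
    ∃ a : ℤ, 2 * jacobiBilin m (fun i => (u i : ℂ)) (fun i => (v i : ℂ)) = a := by
  choose A hA using hm.offDiag
  refine ⟨∑ i, ∑ j, u i * A i j * v j, ?_⟩
  simp only [jacobiBilin, Finset.mul_sum]
  push_cast
  refine Finset.sum_congr rfl fun i _ => Finset.sum_congr rfl fun j _ => ?_
  have : 2 * (m i j : ℂ) = (A i j : ℂ) := by exact_mod_cast congrArg (fun x : ℝ => (x : ℂ)) (hA i j)
  rw [← this]
  ring

theorem jacobiBilin_self_int (hm : IsHalfIntegral m) (u : Fin g → ℤ) :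
    ∃ a : ℤ, jacobiBilin m (fun i => (u i : ℂ)) (fun i => (u i : ℂ)) = a := by
  rw [← Finset.univ_sum_single u]
  induction (Finset.univ : Finset (Fin g)) using Finset.induction_on with
  | empty => exact ⟨0, by simp [jacobiBilin]⟩
  | insert i s hi ih =>
    obtain ⟨a, ha⟩ := ih
    obtain ⟨b, hb⟩ := hm.diag i
    obtain ⟨e, he⟩ := two_mul_jacobiBilin_int hm (Pi.single i (u i)) (∑ j ∈ s, Pi.single j (u j))
    rw [Finset.sum_insert hi]
    set p : Fin g → ℤ := Pi.single i (u i) with hp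
    set q : Fin g → ℤ := ∑ j ∈ s, Pi.single j (u j)
    have hsplit : (fun j => (((p + q) j : ℤ) : ℂ))
        = (fun j => (p j : ℂ)) + (fun j => (q j : ℂ)) := by
      ext j; simp
    have hpp : jacobiBilin m (fun j => (p j : ℂ)) (fun j => (p j : ℂ)) = (u i * b * u i : ℤ) := by
      unfold jacobiBilin
      rw [Finset.sum_eq_single i, Finset.sum_eq_single i]
      · simp [hp, hb]
      · intro j _ hj
        simp [hp, hj]
      · simp
      · intro j _ hj
        simp [hp, hj]
      · simp
    refine ⟨u i * b * u i + e + a, ?_⟩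
    rw [hsplit, jacobiBilin_add_left, jacobiBilin_add_right, jacobiBilin_add_right, ha, hpp,
      jacobiBilin_comm hm (fun j => (q j : ℂ)) (fun j => (p j : ℂ))]
    push_cast
    rw [← he]
    ring

/-- The summand of the Poincaré series only depends on the coset of the stabilizer. -/
theorem jacobiSlash_stabInfty_mul (k : ℤ) (hm : IsHalfIntegral m) (n : ℕ) (r : Fin g → ℤ)
    (δ γ : JacobiGroup g) (hδ : δ ∈ JacobiGroup.stabInfty g) (τ : ℍ) (z : Fin g → ℂ) :
    jacobiSlash k m (jacobiExp n r) (δ * γ) τ z = jacobiSlash k m (jacobiExp n r) γ τ z := by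
  obtain ⟨h1, h2, h3, h4⟩ := hδ
  have hden : ((γ.M 1 0 : ℤ) : ℂ) * (τ : ℂ) + ((γ.M 1 1 : ℤ) : ℂ) ≠ 0 := by
    have := UpperHalfPlane.denom_ne_zero (γ.M : GL (Fin 2) ℝ) τ
    simpa [UpperHalfPlane.denom] using this
  have hM10 : (δ * γ).M 1 0 = γ.M 1 0 := by
    simp [JacobiGroup.mul_M, Matrix.mul_apply, Fin.sum_univ_two, h2, h3]
  have hM11 : (δ * γ).M 1 1 = γ.M 1 1 := by
    simp [JacobiGroup.mul_M, Matrix.mul_apply, Fin.sum_univ_two, h2, h3]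
  have hM00 : (δ * γ).M 0 0 = γ.M 0 0 + δ.M 0 1 * γ.M 1 0 := by
    simp [JacobiGroup.mul_M, Matrix.mul_apply, Fin.sum_univ_two, h1]
  have hM01 : (δ * γ).M 0 1 = γ.M 0 1 + δ.M 0 1 * γ.M 1 1 := by
    simp [JacobiGroup.mul_M, Matrix.mul_apply, Fin.sum_univ_two, h1]
  have hact : ((((δ * γ).M • τ : ℍ)) : ℂ) = ((γ.M • τ : ℍ) : ℂ) + (δ.M 0 1 : ℤ) := by
    have e1 := UpperHalfPlane.coe_specialLinearGroup_apply (δ * γ).M τ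
    have e2 := UpperHalfPlane.coe_specialLinearGroup_apply γ.M τ
    rw [e1, e2, hM10, hM11, hM00, hM01]
    simp only [algebraMap_int_eq, eq_intCast, Complex.ofReal_intCast]
    rw [div_add' _ _ _ hden]
    congr 1
    push_cast
    ring
  set ν : Fin g → ℂ := fun i => (δ.mu i : ℂ) with hν
  set l : Fin g → ℂ := fun i => (γ.lam i : ℂ) with hl
  set u : Fin g → ℂ := fun i => (γ.mu i : ℂ) with hu
  set c : ℂ := ((γ.M 1 0 : ℤ) : ℂ) with hc
  set d : ℂ := ((γ.M 1 1 : ℤ) : ℂ) with hd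
  have hlam : (fun i => (((δ * γ).lam i : ℤ) : ℂ)) = l + c • ν := by
    ext i
    simp [JacobiGroup.mul_lam, h4, hl, hc, hν]
    ring
  have hmu : ∀ i, (((δ * γ).mu i : ℤ) : ℂ) = u i + d * ν i := by
    intro i
    simp [JacobiGroup.mul_mu, h4, hu, hd, hν]
    ring
  have hw : (fun i => z i + (((δ * γ).lam i : ℤ) : ℂ) * (τ : ℂ) + (((δ * γ).mu i : ℤ) : ℂ))
      = (z + (τ : ℂ) • l + u) + (c * τ + d) • ν := by
    ext i
    have := congrFun hlam i
    simp only [Pi.add_apply, Pi.smul_apply, smul_eq_mul] at this ⊢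
    rw [this, hmu]
    ring
  have hw' : (fun i => z i + ((γ.lam i : ℤ) : ℂ) * (τ : ℂ) + ((γ.mu i : ℤ) : ℂ))
      = z + (τ : ℂ) • l + u := by
    ext i
    simp [hl, hu]
    ring
  obtain ⟨a1, ha1⟩ := two_mul_jacobiBilin_int hm γ.mu δ.mu
  obtain ⟨a2, ha2⟩ := jacobiBilin_self_int hm δ.mu
  have hexp : jacobiExp n r ((δ * γ).M • τ)
        (fun i => (c * τ + d)⁻¹ * ((z + (τ : ℂ) • l + u) + (c * τ + d) • ν) i)
      = jacobiExp n r (γ.M • τ) (fun i => (c * τ + d)⁻¹ * (z + (τ : ℂ) • l + u) i) := by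
    unfold jacobiExp
    rw [hact]
    rw [← expTwoPiI_add_int (_ + ∑ i, (r i : ℂ) * ((c * τ + d)⁻¹ * (z + (τ : ℂ) • l + u) i))
      ((n : ℤ) * δ.M 0 1 + ∑ i, r i * δ.mu i)]
    congr 1
    have : ∀ i, (r i : ℂ) * ((c * τ + d)⁻¹ * ((z + (τ : ℂ) • l + u) + (c * τ + d) • ν) i)
        = (r i : ℂ) * ((c * τ + d)⁻¹ * (z + (τ : ℂ) • l + u) i) + (r i : ℂ) * (δ.mu i : ℂ) := by
      intro i
      simp only [Pi.add_apply, Pi.smul_apply, smul_eq_mul, hν]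
      field_simp
    simp_rw [this]
    rw [Finset.sum_add_distrib]
    push_cast
    ring
  have hfac : expTwoPiI (-c * (c * τ + d)⁻¹ *
          jacobiBilin m ((z + (τ : ℂ) • l + u) + (c * τ + d) • ν)
            ((z + (τ : ℂ) • l + u) + (c * τ + d) • ν)
        + jacobiBilin m (l + c • ν) (l + c • ν) * τ + 2 * jacobiBilin m (l + c • ν) z)
      = expTwoPiI (-c * (c * τ + d)⁻¹ *
          jacobiBilin m (z + (τ : ℂ) • l + u) (z + (τ : ℂ) • l + u)
        + jacobiBilin m l l * τ + 2 * jacobiBilin m l z) := by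
    rw [← expTwoPiI_add_int (-c * (c * τ + d)⁻¹ *
          jacobiBilin m (z + (τ : ℂ) • l + u) (z + (τ : ℂ) • l + u)
        + jacobiBilin m l l * τ + 2 * jacobiBilin m l z)
        (-(γ.M 1 0 * a1) - γ.M 1 0 * γ.M 1 1 * a2)]
    congr 1
    push_cast
    rw [← ha1, ← ha2]
    simp only [jacobiBilin_add_left, jacobiBilin_add_right, jacobiBilin_smul_left,
      jacobiBilin_smul_right, ← hc, ← hd]
    rw [jacobiBilin_comm hm ν z, jacobiBilin_comm hm ν l, jacobiBilin_comm hm ν u]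
    field_simp
    ring
  unfold jacobiSlash
  simp only [hw, hw', hlam, hM10, hM11]
  rw [← hc, ← hd, ← hl, hfac]
  have e1 := fun i => congrFun hw i
  have e2 := fun i => congrFun hw' i
  simp only [e1, e2, hexp]

end Invariance

end

/-!
Fix `τ` in the upper half plane and write `z = pτ + q` with `p, q ∈ ℝ^g`. After multiplication by
`e(pᵗ m z)`, Jacobi forms of index `m` become functions of `(p, q)` whose absolute value lives on
the torus `ℝ^{2g} / ℤ^{2g}`, and the modular substitution `M` acts by the linear map `M⁻¹` on the
torus (`expTwoPiI_mul_jacobiSlash`). Summing `e(nτ + rz)` over the lattice translations gives a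
theta function `θ`, and the Poincaré series is the sum of `(cτ + d)^{-k} θ(Mτ, (p, q) M⁻¹)` over
the coprime pairs `(c, d)` (`jacobiPoincare_eq_tsum`).

If the Poincaré series vanishes for some `τ`, its pairing with `θ` over the torus is zero. In this
pairing `(0, 1)` contributes `‖θ‖²`, and `(0, -1)` contributes a non-negative number: `θ` is
either even, and then `k` is even, or orthogonal to its reflection. For `c ≠ 0` the
Cauchy–Schwarz inequality applies. It loses little: by Parseval's formula `‖θ‖²` at `τ` is the
Gaussian integral `∫ exp(-4π Im(τ) N(p)) dp` with `N(p) = m[p] + rp + n`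
(`setLIntegral_enorm_theta_sq`), and `SL(2, ℤ)` preserves integrals over the torus
(`setLIntegral_comp_torusSubst`). Put `T = πD / det(2m) = 2π min N`, `q = (k - g/2) / 2` and
`Im τ = q / T`. Then the contribution of `(c, d)` is at most `‖θ‖²` times `(e^{1 - 1/ρ} / ρ)^q`
with `ρ = |cτ + d|²` (`norm_pairing_le`). This function of `ρ` is at most `1`, and is concentrated
around `ρ = 1` on the scale `q^{-1/2}`.

It remains to find `τ` on the horizontal line such that these factors, summed over the rows with
`c ≠ 0`, give less than `1`. The average over `Re τ` of the sum over `d` is the integral over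
`t ∈ ℝ` of the factor with `ρ = t² + (c Im τ)²` (`exists_tsum_saddle_le`). The set where `ρ` is
within `O(δ)` of `1` has measure `O(√δ)`, and it is empty unless `|c| ≤ 2 / Im τ`; off this set
the factor is `O(exp(-δ² q) ρ⁻²)`. With `δ = q^{-4/9}` the total is
`O(q^{-2/9} T / q) + O(q exp(-q^{1/9}))` (`tsum_lintegral_saddle_le`, `eventually_error_lt_one`),
and this tends to `0` because `α(g) ≤ 2/9` and `exp(-B log k' / log log k')` tends to `0`.
-/

namespace JacobiPoincare

open MeasureTheory Filter Topology

/-! ### Cosets of the stabilizer in the Jacobi group -/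

section Cosets

variable {g : ℕ}

/-- The element `(1, (lam, 0))` of the Jacobi group. -/
def translation (lam : Fin g → ℤ) : JacobiGroup g := ⟨1, lam, 0⟩

/-- The element `(M, (0, 0))` of the Jacobi group. -/
def ofSL (M : SL(2, ℤ)) : JacobiGroup g := ⟨M, 0, 0⟩

/-- Coprime pairs `(c, d)` of integers, the bottom rows of matrices in `SL(2, ℤ)`. -/
abbrev CoprimePair : Type := {s : Fin 2 → ℤ // IsCoprime (s 0) (s 1)}

/-- There is a choice of representatives in `SL(2, ℤ)` with prescribed bottom rows that picks
`1` and `-1` over the rows `(0, 1)` and `(0, -1)`. -/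
theorem exists_bottomRow_section :
    ∃ M : CoprimePair → SL(2, ℤ), (∀ s i, M s 1 i = s.1 i) ∧
      (∀ s, s.1 0 = 0 → s.1 1 = 1 → M s = 1) ∧ (∀ s, s.1 0 = 0 → s.1 1 = -1 → M s = -1) := by
  have key : ∀ s : CoprimePair, ∃ M : SL(2, ℤ), (∀ i, M 1 i = s.1 i) ∧
      (s.1 0 = 0 → s.1 1 = 1 → M = 1) ∧ (s.1 0 = 0 → s.1 1 = -1 → M = -1) := by
    intro s
    by_cases h0 : s.1 0 = 0
    · have hu : IsUnit (s.1 1) := by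
        have := s.2
        rw [h0] at this
        exact isCoprime_zero_left.mp this
      rcases Int.isUnit_iff.mp hu with h1 | h1
      · refine ⟨1, fun i => ?_, fun _ _ => rfl, fun _ h => by omega⟩
        fin_cases i <;> simp [h0, h1]
      · refine ⟨-1, fun i => ?_, fun _ h => by omega, fun _ _ => rfl⟩
        fin_cases i <;> simp [h0, h1]
    · obtain ⟨M, -, hM⟩ := ModularGroup.bottom_row_surj (R := ℤ) s.2
      exact ⟨M, fun i => congrFun hM i, fun h => absurd h h0, fun h => absurd h h0⟩
  choose M h1 h2 h3 using key
  exact ⟨M, h1, h2, h3⟩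

/-- The coset of the representative attached to a bottom row and a lattice vector. -/
def cosetMk (M : CoprimePair → SL(2, ℤ)) (x : CoprimePair × (Fin g → ℤ)) :
    Quotient (QuotientGroup.rightRel (JacobiGroup.stabInfty g)) :=
  Quotient.mk _ (translation x.2 * ofSL (M x.1))

theorem cosetMk_bijective {M : CoprimePair → SL(2, ℤ)} (hM : ∀ s i, M s 1 i = s.1 i) :
    Function.Bijective (cosetMk (g := g) M) := by
  constructor
  · rintro ⟨s, l⟩ ⟨s', l'⟩ h
    have h := Quotient.exact h
    have h : (QuotientGroup.rightRel (JacobiGroup.stabInfty g))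
      (translation l * ofSL (M s)) (translation l' * ofSL (M s')) := h
    rw [QuotientGroup.rightRel_apply] at h
    have hrow : ∀ i, M s' 1 i = M s 1 i := by
      set δ := translation l' * ofSL (M s') * (translation l * ofSL (M s))⁻¹ with hδ
      have e : δ * (translation l * ofSL (M s)) = translation l' * ofSL (M s') := by
        rw [hδ]; group
      have e' := congrArg JacobiGroup.M e
      simp only [JacobiGroup.mul_M, translation, ofSL, one_mul] at e'
      intro i
      rw [← e']
      simp [Matrix.mul_apply, Fin.sum_univ_two, h.2.1, h.2.2.1]
    have hs : s' = s := by
      ext i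
      rw [← hM, ← hM]
      exact hrow i
    subst hs
    have h4 := h.2.2.2
    have e : translation l' * ofSL (M s') * (translation l * ofSL (M s'))⁻¹
        = translation l' * (translation l)⁻¹ := by group
    rw [e] at h4
    ext1
    · rfl
    · funext i
      have := congrFun h4 i
      simp [JacobiGroup.mul_lam, JacobiGroup.inv_lam, JacobiGroup.inv_M, translation] at this
      show l i = l' i
      linarith
  · intro x
    obtain ⟨γ, rfl⟩ := Quotient.exists_rep x
    let s : CoprimePair := ⟨γ.M 1, ModularGroup.bottom_row_coprime γ.M⟩
    have hdetN := (M s).det_coe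
    have hdetG := γ.M.det_coe
    rw [Matrix.det_fin_two] at hdetN hdetG
    have hs0 : M s 1 0 = γ.M 1 0 := hM s 0
    have hs1 : M s 1 1 = γ.M 1 1 := hM s 1
    set Y : JacobiGroup g := γ * (ofSL (M s))⁻¹ with hY
    have hYγ : Y * ofSL (M s) = γ := by simp [hY]
    refine ⟨(s, Y.lam), ?_⟩
    apply Quotient.sound
    show (QuotientGroup.rightRel (JacobiGroup.stabInfty g)) _ _
    rw [QuotientGroup.rightRel_apply]
    have e : γ * (translation Y.lam * ofSL (M s))⁻¹ = Y * (translation Y.lam)⁻¹ := by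
      simp only [hY]; group
    rw [e]
    refine ⟨?_, ?_, ?_, ?_⟩
    · simp [JacobiGroup.mul_M, JacobiGroup.inv_M, translation, hY, ofSL,
        Matrix.mul_apply, Fin.sum_univ_two, Matrix.adjugate_fin_two]
      rw [hs0, hs1]; linarith
    · simp [JacobiGroup.mul_M, JacobiGroup.inv_M, translation, hY, ofSL,
        Matrix.mul_apply, Fin.sum_univ_two, Matrix.adjugate_fin_two]
      rw [hs0, hs1]; ring
    · simp [JacobiGroup.mul_M, JacobiGroup.inv_M, translation, hY, ofSL,
        Matrix.mul_apply, Fin.sum_univ_two, Matrix.adjugate_fin_two]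
      rw [← hs0, ← hs1]; linarith
    · ext i
      simp [JacobiGroup.mul_lam, JacobiGroup.inv_lam, JacobiGroup.inv_M, translation]

/-- The Poincaré series as a sum over bottom rows `(c, d)` and lattice vectors. -/
theorem jacobiPoincare_eq_tsum {M : CoprimePair → SL(2, ℤ)} (hM : ∀ s i, M s 1 i = s.1 i)
    (k : ℤ) {m : Matrix (Fin g) (Fin g) ℝ} (hm : IsHalfIntegral m) (n : ℕ) (r : Fin g → ℤ)
    (τ : ℍ) (z : Fin g → ℂ) :
    jacobiPoincare k m n r τ z = ∑' x : CoprimePair × (Fin g → ℤ),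
      jacobiSlash k m (jacobiExp n r) (translation x.2 * ofSL (M x.1)) τ z := by
  unfold jacobiPoincare
  rw [← (Equiv.ofBijective _ (cosetMk_bijective hM)).tsum_eq]
  refine tsum_congr fun x => ?_
  have hrel : (QuotientGroup.rightRel (JacobiGroup.stabInfty g))
      (translation x.2 * ofSL (M x.1)) (cosetMk M x).out :=
    Quotient.exact (Quotient.out_eq (cosetMk M x)).symm
  rw [QuotientGroup.rightRel_apply] at hrel
  have := jacobiSlash_stabInfty_mul k hm n r _ (translation x.2 * ofSL (M x.1)) hrel τ z
  rw [← this, inv_mul_cancel_right]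
  rfl

end Cosets

/-! ### Theta coordinates -/

section ThetaTerm

variable {g : ℕ}

/-- The quadratic polynomial `N(p) = m[p] + r p + n` on `ℝ^g`. -/
noncomputable def quadPoly (m : Matrix (Fin g) (Fin g) ℝ) (n : ℕ) (r : Fin g → ℤ) (p : Fin g → ℝ) : ℝ :=
  p ⬝ᵥ m.mulVec p + (∑ i, (r i : ℝ) * p i) + n

/-- The summand `e(N(p + lam) τ + pᵗ m q + (r + 2 lamᵗ m) q)` of the theta function attached to
`(n, r)`. It is `e(nτ + rz)|(1, (lam, 0))` at `z = pτ + q`, multiplied by `e(pᵗ m z)`. -/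
noncomputable def thetaTerm (m : Matrix (Fin g) (Fin g) ℝ) (n : ℕ) (r : Fin g → ℤ) (lam : Fin g → ℤ) (τ : ℍ)
    (p q : Fin g → ℝ) : ℂ :=
  expTwoPiI ((quadPoly m n r (fun i => p i + lam i) : ℂ) * τ
    + jacobiBilin m (fun i => (p i : ℂ)) (fun i => (q i : ℂ))
    + ((∑ i, (r i : ℂ) * q i)
      + 2 * jacobiBilin m (fun i => (lam i : ℂ)) (fun i => (q i : ℂ))))

theorem ofReal_dotProduct_mulVec (m : Matrix (Fin g) (Fin g) ℝ) (x y : Fin g → ℝ) :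
    ((x ⬝ᵥ m.mulVec y : ℝ) : ℂ) = jacobiBilin m (fun i => (x i : ℂ)) (fun i => (y i : ℂ)) := by
  simp [jacobiBilin, dotProduct, Matrix.mulVec, Finset.mul_sum, mul_assoc]

/-- In the coordinates `z = pτ + q` and after multiplication by `e(pᵗ m z)`, the modular
substitution `M` acts on a theta summand by the linear substitution `M⁻¹` on `(p, q)`. -/
theorem expTwoPiI_mul_jacobiSlash (k : ℤ) {m : Matrix (Fin g) (Fin g) ℝ} (hm : IsHalfIntegral m)
    (n : ℕ) (r : Fin g → ℤ) (M : SL(2, ℤ)) (lam : Fin g → ℤ) (τ : ℍ) (p q : Fin g → ℝ) :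
    expTwoPiI (jacobiBilin m (fun i => (p i : ℂ)) (fun i => (p i : ℂ) * τ + q i)) *
        jacobiSlash k m (jacobiExp n r) (translation lam * ofSL M) τ
          (fun i => (p i : ℂ) * τ + q i)
      = (((M 1 0 : ℤ) : ℂ) * τ + ((M 1 1 : ℤ) : ℂ)) ^ (-k) *
        thetaTerm m n r lam (M • τ) (fun i => (M 1 1 : ℤ) * p i - (M 1 0 : ℤ) * q i)
          (fun i => (M 0 0 : ℤ) * q i - (M 0 1 : ℤ) * p i) := by
  have hden : ((M 1 0 : ℤ) : ℂ) * (τ : ℂ) + ((M 1 1 : ℤ) : ℂ) ≠ 0 := by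
    have := UpperHalfPlane.denom_ne_zero (M : GL (Fin 2) ℝ) τ
    simpa [UpperHalfPlane.denom] using this
  have hact := UpperHalfPlane.coe_specialLinearGroup_apply M τ
  simp only [algebraMap_int_eq, eq_intCast, Complex.ofReal_intCast] at hact
  have hdet : ((M 0 0 : ℤ) : ℂ) * ((M 1 1 : ℤ) : ℂ) - ((M 0 1 : ℤ) : ℂ) * ((M 1 0 : ℤ) : ℂ) = 1 := by
    have := M.det_coe
    rw [Matrix.det_fin_two] at this
    exact_mod_cast this
  obtain ⟨e0, he0⟩ := jacobiBilin_self_int hm lam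
  set P : Fin g → ℂ := fun i => (p i : ℂ) with hP
  set Q : Fin g → ℂ := fun i => (q i : ℂ) with hQ
  set l : Fin g → ℂ := fun i => (lam i : ℂ) with hl
  set R : (Fin g → ℂ) → ℂ := fun x => ∑ i, (r i : ℂ) * x i with hR
  have hRadd : ∀ x y, R (x + y) = R x + R y := by
    intro x y; simp [hR, mul_add, Finset.sum_add_distrib]
  have hRsmul : ∀ (t : ℂ) x, R (t • x) = t * R x := by
    intro t x
    simp only [hR, Pi.smul_apply, smul_eq_mul, Finset.mul_sum]
    exact Finset.sum_congr rfl fun i _ => by ring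
  set a : ℂ := ((M 0 0 : ℤ) : ℂ) with ha
  set b : ℂ := ((M 0 1 : ℤ) : ℂ) with hb
  set c : ℂ := ((M 1 0 : ℤ) : ℂ) with hc
  set d : ℂ := ((M 1 1 : ℤ) : ℂ) with hd
  have hz : (fun i => (p i : ℂ) * (τ : ℂ) + (q i : ℂ)) = (τ : ℂ) • P + Q := by
    ext i; simp [hP, hQ]; ring
  have hlam' : (fun i => (((translation lam * ofSL M).lam i : ℤ) : ℂ)) = a • l := by
    ext i; simp [JacobiGroup.mul_lam, translation, ofSL, ha, hl]
  have hw : (fun i => ((p i : ℂ) * (τ : ℂ) + (q i : ℂ))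
      + (((translation lam * ofSL M).lam i : ℤ) : ℂ) * (τ : ℂ)
      + (((translation lam * ofSL M).mu i : ℤ) : ℂ)) = (τ : ℂ) • P + Q + (a * τ + b) • l := by
    ext i
    simp [JacobiGroup.mul_lam, JacobiGroup.mul_mu, translation, ofSL, ha, hb, hl, hP, hQ]
    ring
  have hMM : (translation lam * ofSL M : JacobiGroup g).M = M := by
    simp [JacobiGroup.mul_M, translation, ofSL]
  have hexp : jacobiExp n r (M • τ)
      (fun i => (c * τ + d)⁻¹ * ((τ : ℂ) • P + Q + (a * τ + b) • l) i)
      = expTwoPiI (n * ((a * τ + b) / (c * τ + d)) +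
        (c * τ + d)⁻¹ * (τ * R P + R Q + (a * τ + b) * R l)) := by
    unfold jacobiExp
    rw [hact]
    congr 2
    rw [← hRsmul, ← hRsmul, ← hRadd, ← hRadd, ← hRsmul]
    rfl
  have hp' : (fun i => (((((M 1 1 : ℤ) : ℝ) * p i - ((M 1 0 : ℤ) : ℝ) * q i : ℝ)) : ℂ))
      = d • P + (-c) • Q := by
    ext i; simp [hP, hQ, hc, hd]; ring
  have hq' : (fun i => (((((M 0 0 : ℤ) : ℝ) * q i - ((M 0 1 : ℤ) : ℝ) * p i : ℝ)) : ℂ))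
      = a • Q + (-b) • P := by
    ext i; simp [hP, hQ, ha, hb]; ring
  have hNpoly : ((quadPoly m n r (fun i => (((M 1 1 : ℤ) : ℝ) * p i - ((M 1 0 : ℤ) : ℝ) * q i)
      + lam i) : ℝ) : ℂ)
      = jacobiBilin m (d • P + (-c) • Q + l) (d • P + (-c) • Q + l)
        + (d * R P - c * R Q + R l) + n := by
    have hv : (fun i => (((((M 1 1 : ℤ) : ℝ) * p i - ((M 1 0 : ℤ) : ℝ) * q i) + lam i : ℝ) : ℂ))
        = d • P + (-c) • Q + l := by
      ext i; simp [hP, hQ, hc, hd, hl]; ring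
    unfold quadPoly
    rw [Complex.ofReal_add, Complex.ofReal_add, ofReal_dotProduct_mulVec, hv]
    have : d * R P - c * R Q + R l = R (d • P + (-c) • Q + l) := by
      rw [hRadd, hRadd, hRsmul, hRsmul]; ring
    rw [this, ← hv]
    simp [hR]
  unfold jacobiSlash thetaTerm
  simp only [hMM]
  have hw_i := fun i => congrFun hw i
  simp only [hw]
  simp only [hw_i]
  rw [← hc, ← hd, hexp, hlam', hz, hp', hq', hNpoly, hact]
  have hRq' : (∑ i, (r i : ℂ) * (((((M 0 0 : ℤ) : ℝ) * q i - ((M 0 1 : ℤ) : ℝ) * p i : ℝ)) : ℂ))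
      = a * R Q - b * R P := by
    have : a * R Q - b * R P = R (a • Q + (-b) • P) := by
      rw [hRadd, hRsmul, hRsmul]; ring
    rw [this, ← hq']
  rw [hRq', mul_left_comm, mul_assoc]
  -- The two exponents differ by the integer `a b m[lam]`.
  congr 1
  rw [← expTwoPiI_add_int (_ + _ + (_ + _)) (-(M 0 0 * M 0 1 * e0))]
  unfold expTwoPiI
  rw [← Complex.exp_add, ← Complex.exp_add]
  congr 1
  simp only [← mul_add]
  congr 1
  push_cast
  rw [← he0, ← ha, ← hb]
  simp only [jacobiBilin_add_left, jacobiBilin_add_right, jacobiBilin_smul_left,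
      jacobiBilin_smul_right]
  rw [jacobiBilin_comm hm Q P, jacobiBilin_comm hm l P, jacobiBilin_comm hm l Q]
  generalize jacobiBilin m P P = PP
  generalize jacobiBilin m P Q = PQ
  generalize jacobiBilin m P l = Pl
  generalize jacobiBilin m Q Q = QQ
  generalize jacobiBilin m Q l = Ql
  generalize jacobiBilin m l l = ll
  generalize R P = RP
  generalize R Q = RQ
  generalize R l = Rl
  generalize (τ : ℂ) = t at *
  clear_value a b c d
  field_simp
  linear_combination (-(d * t) * PP - (d - c * t) * PQ + c * QQ + (a * t + b) * ll - t * RP - RQ) * hdet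

end ThetaTerm

/-! ### Unfolding integrals and the action of `SL(2, ℤ)` on the torus -/

section Unfolding

open scoped ENNReal

/-- Unfolding along a lattice `ι : Λ → E`, whose fundamental domain is the zero set of a
"floor" map `E → Λ`. -/
theorem lintegral_eq_tsum_of_floor {E Λ : Type*} [AddGroup E] [MeasurableSpace E]
    [MeasurableAdd E] {μ : Measure E} [μ.IsAddRightInvariant] [AddGroup Λ] [Countable Λ]
    [MeasurableSpace Λ] [MeasurableSingletonClass Λ] (ι : Λ → E) (fl : E → Λ)
    (hfl : Measurable fl) (hadd : ∀ x l, fl (x + ι l) = fl x + l) (h : E → ℝ≥0∞) :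
    ∫⁻ x, h x ∂μ = ∑' l, ∫⁻ x in fl ⁻¹' {0}, h (x + ι l) ∂μ := by
  have hms : ∀ l, MeasurableSet (fl ⁻¹' {l}) := fun l => hfl (measurableSet_singleton l)
  have hU : (⋃ l, fl ⁻¹' {l}) = Set.univ := by
    ext x; simp
  rw [← setLIntegral_univ, ← hU, lintegral_iUnion hms]
  · refine tsum_congr fun l => ?_
    rw [← lintegral_indicator (hms l), ← lintegral_indicator (hms 0),
      ← lintegral_add_right_eq_self _ (ι l)]
    refine lintegral_congr fun x => ?_
    by_cases hx : fl x = 0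
    · have h1 : x ∈ fl ⁻¹' {0} := hx
      have h2 : x + ι l ∈ fl ⁻¹' {l} := by simp [hadd, hx]
      rw [Set.indicator_of_mem h1, Set.indicator_of_mem h2]
    · have h1 : x ∉ fl ⁻¹' {0} := hx
      have h2 : x + ι l ∉ fl ⁻¹' {l} := by simpa [hadd] using hx
      rw [Set.indicator_of_notMem h1, Set.indicator_of_notMem h2]
  · intro l l' hll
    rw [Function.onFun, Set.disjoint_left]
    intro x hx hx'
    exact hll (by rw [← (hx : fl x = l), ← (hx' : fl x = l')])

variable {g : ℕ}

/-- The half-open unit cube `[0, 1)^g`. -/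
def unitCube (g : ℕ) : Set (Fin g → ℝ) := Set.univ.pi fun _ => Set.Ico 0 1

theorem measurableSet_unitCube : MeasurableSet (unitCube g) :=
  MeasurableSet.univ_pi fun _ => measurableSet_Ico

theorem volume_unitCube : volume (unitCube g) = 1 := by
  simp [unitCube, volume_pi_pi]

instance : IsProbabilityMeasure ((volume : Measure (Fin g → ℝ)).restrict (unitCube g)) :=
  ⟨by simp [volume_unitCube]⟩

/-- The coordinatewise floor. -/
noncomputable def floorVec (x : Fin g → ℝ) : Fin g → ℤ := fun i => ⌊x i⌋

theorem measurable_floorVec : Measurable (floorVec (g := g)) :=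
  measurable_pi_lambda _ fun i => Int.measurable_floor.comp (measurable_pi_apply i)

theorem floorVec_preimage_zero : floorVec (g := g) ⁻¹' {0} = unitCube g := by
  ext x
  simp [floorVec, unitCube, funext_iff, Int.floor_eq_zero_iff]

theorem floorVec_add_intCast (x : Fin g → ℝ) (l : Fin g → ℤ) :
    floorVec (fun i => x i + l i) = floorVec x + l := by
  ext i; simp [floorVec]

theorem lintegral_eq_tsum_unitCube (h : (Fin g → ℝ) → ℝ≥0∞) :
    ∫⁻ x, h x = ∑' l : Fin g → ℤ, ∫⁻ x in unitCube g, h (fun i => x i + l i) := by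
  have := lintegral_eq_tsum_of_floor (μ := (volume : Measure (Fin g → ℝ)))
    (fun (l : Fin g → ℤ) => fun i => (l i : ℝ)) floorVec measurable_floorVec
    (fun x l => floorVec_add_intCast x l) h
  rw [floorVec_preimage_zero] at this
  exact this

/-- The fundamental domain `[0, 1)^g × [0, 1)^g` of the torus `ℝ^{2g} / ℤ^{2g}`. -/
def torusDomain (g : ℕ) : Set ((Fin g → ℝ) × (Fin g → ℝ)) := unitCube g ×ˢ unitCube g

theorem measurableSet_torusDomain : MeasurableSet (torusDomain g) :=
  measurableSet_unitCube.prod measurableSet_unitCube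

theorem volume_torusDomain : volume (torusDomain g) = 1 := by
  rw [torusDomain, Measure.volume_eq_prod, Measure.prod_prod, volume_unitCube, one_mul]

instance : IsProbabilityMeasure
    ((volume : Measure ((Fin g → ℝ) × (Fin g → ℝ))).restrict (torusDomain g)) :=
  ⟨by simp [volume_torusDomain]⟩

instance : (volume : Measure ((Fin g → ℝ) × (Fin g → ℝ))).IsAddHaarMeasure := by
  rw [Measure.volume_eq_prod]
  exact Measure.prod.instIsAddHaarMeasure _ _

theorem restrict_torusDomain :
    (volume : Measure ((Fin g → ℝ) × (Fin g → ℝ))).restrict (torusDomain g)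
      = (volume.restrict (unitCube g)).prod (volume.restrict (unitCube g)) := by
  rw [torusDomain, Measure.volume_eq_prod, Measure.prod_restrict]

/-- Invariance under translations by `ℤ^g × ℤ^g`. -/
def TorusPeriodic {α : Type*} (f : (Fin g → ℝ) × (Fin g → ℝ) → α) : Prop :=
  ∀ (l μ : Fin g → ℤ) p q, f (fun i => p i + l i, fun i => q i + μ i) = f (p, q)

/-- The linear substitution `(p, q) ↦ (p, q) M⁻¹ = (d p - c q, a q - b p)`. -/
noncomputable def torusSubst (M : SL(2, ℤ)) :
    ((Fin g → ℝ) × (Fin g → ℝ)) ≃ₗ[ℝ] ((Fin g → ℝ) × (Fin g → ℝ)) where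
  toFun x := (fun i => ((M 1 1 : ℤ) : ℝ) * x.1 i - ((M 1 0 : ℤ) : ℝ) * x.2 i,
    fun i => ((M 0 0 : ℤ) : ℝ) * x.2 i - ((M 0 1 : ℤ) : ℝ) * x.1 i)
  invFun x := (fun i => ((M 0 0 : ℤ) : ℝ) * x.1 i + ((M 1 0 : ℤ) : ℝ) * x.2 i,
    fun i => ((M 1 1 : ℤ) : ℝ) * x.2 i + ((M 0 1 : ℤ) : ℝ) * x.1 i)
  map_add' x y := by ext i <;> simp <;> ring
  map_smul' t x := by ext i <;> simp <;> ring
  left_inv x := by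
    have h : ((M 0 0 : ℤ) : ℝ) * ((M 1 1 : ℤ) : ℝ) - ((M 0 1 : ℤ) : ℝ) * ((M 1 0 : ℤ) : ℝ) = 1 := by
      have := M.det_coe
      rw [Matrix.det_fin_two] at this
      exact_mod_cast this
    ext i
    · simp only; linear_combination (x.1 i) * h
    · simp only; linear_combination (x.2 i) * h
  right_inv x := by
    have h : ((M 0 0 : ℤ) : ℝ) * ((M 1 1 : ℤ) : ℝ) - ((M 0 1 : ℤ) : ℝ) * ((M 1 0 : ℤ) : ℝ) = 1 := by
      have := M.det_coe
      rw [Matrix.det_fin_two] at this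
      exact_mod_cast this
    ext i
    · simp only; linear_combination (x.1 i) * h
    · simp only; linear_combination (x.2 i) * h

theorem continuous_torusSubst (M : SL(2, ℤ)) : Continuous (torusSubst (g := g) M) := by
  exact (torusSubst (g := g) M).toLinearMap.continuous_of_finiteDimensional

theorem continuous_torusSubst_symm (M : SL(2, ℤ)) :
    Continuous (torusSubst (g := g) M).symm := by
  exact (torusSubst (g := g) M).symm.toLinearMap.continuous_of_finiteDimensional

theorem TorusPeriodic.comp_torusSubst {α : Type*} {f : (Fin g → ℝ) × (Fin g → ℝ) → α}
    (hf : TorusPeriodic f) (M : SL(2, ℤ)) : TorusPeriodic fun x => f (torusSubst M x) := by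
  intro l μ p q
  show f (torusSubst M _) = f (torusSubst M (p, q))
  refine Eq.trans ?_ (hf (fun i => M 1 1 * l i - M 1 0 * μ i) (fun i => M 0 0 * μ i - M 0 1 * l i) _ _)
  congr 1
  ext i
  · simp [torusSubst]; ring
  · simp [torusSubst]; ring

/-- The integer lattice `ℤ^{2g}` as vectors of `ℝ^{2g}`. -/
def latticeVec (l : (Fin g → ℤ) × (Fin g → ℤ)) : (Fin g → ℝ) × (Fin g → ℝ) :=
  (fun i => l.1 i, fun i => l.2 i)

/-- The floor of a vector of `ℝ^{2g}`. -/
noncomputable def floorPair (x : (Fin g → ℝ) × (Fin g → ℝ)) : (Fin g → ℤ) × (Fin g → ℤ) :=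
  (floorVec x.1, floorVec x.2)

theorem floorPair_add (x : (Fin g → ℝ) × (Fin g → ℝ)) (l : (Fin g → ℤ) × (Fin g → ℤ)) :
    floorPair (x + latticeVec l) = floorPair x + l :=
  Prod.ext (floorVec_add_intCast x.1 l.1) (floorVec_add_intCast x.2 l.2)

theorem floorPair_preimage_zero : floorPair (g := g) ⁻¹' {0} = torusDomain g := by
  rw [torusDomain, ← floorVec_preimage_zero]
  ext x
  simp [floorPair, Prod.ext_iff]

theorem measurable_floorPair : Measurable (floorPair (g := g)) :=
  (measurable_floorVec.comp measurable_fst).prodMk (measurable_floorVec.comp measurable_snd)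

theorem tsum_indicator_torusDomain (x : (Fin g → ℝ) × (Fin g → ℝ)) :
    ∑' l, (torusDomain g).indicator (fun _ => (1 : ℝ≥0∞)) (x + latticeVec l) = 1 := by
  have hmem : ∀ l, x + latticeVec l ∈ torusDomain g ↔ l = -floorPair x := by
    intro l
    rw [← floorPair_preimage_zero, Set.mem_preimage, floorPair_add, Set.mem_singleton_iff,
      add_comm, add_eq_zero_iff_eq_neg]
  rw [tsum_eq_single (-floorPair x)]
  · rw [Set.indicator_of_mem ((hmem _).2 rfl)]
  · intro l hl
    exact Set.indicator_of_notMem (fun h => hl ((hmem l).1 h)) _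

/-- `SL(2, ℤ)` preserves integrals over the torus `ℝ^{2g} / ℤ^{2g}`. -/
theorem setLIntegral_comp_torusSubst (M : SL(2, ℤ)) {f : (Fin g → ℝ) × (Fin g → ℝ) → ℝ≥0∞}
    (hfm : Measurable f) (hf : TorusPeriodic f) :
    ∫⁻ x in torusDomain g, f (torusSubst M x) = ∫⁻ x in torusDomain g, f x := by
  set L := torusSubst (g := g) M with hL
  have hdet : LinearMap.det L.toLinearMap ≠ 0 := L.isUnit_det'.ne_zero
  obtain ⟨c, hc⟩ : ∃ c : ℝ≥0∞, Measure.map L volume = c • volume :=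
    ⟨_, Measure.map_linearMap_addHaar_eq_smul_addHaar volume hdet⟩
  have hLm : Measurable L := (continuous_torusSubst M).measurable
  have hLsm : Measurable L.symm := (continuous_torusSubst_symm M).measurable
  have hsymm : ∀ x l, L.symm (x + latticeVec l)
      = L.symm x + latticeVec (fun i => M 0 0 * l.1 i + M 1 0 * l.2 i,
        fun i => M 1 1 * l.2 i + M 0 1 * l.1 i) := by
    intro x l
    rw [map_add]
    congr 1
    ext i <;> simp [hL, torusSubst, latticeVec]
  have hbij : Function.Bijective fun l : (Fin g → ℤ) × (Fin g → ℤ) =>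
      ((fun i => M 0 0 * l.1 i + M 1 0 * l.2 i, fun i => M 1 1 * l.2 i + M 0 1 * l.1 i) :
        (Fin g → ℤ) × (Fin g → ℤ)) := by
    have h : M 0 0 * M 1 1 - M 0 1 * M 1 0 = 1 := by
      have := M.det_coe
      rwa [Matrix.det_fin_two] at this
    refine Function.bijective_iff_has_inverse.2 ⟨fun l =>
      (fun i => M 1 1 * l.1 i - M 1 0 * l.2 i, fun i => M 0 0 * l.2 i - M 0 1 * l.1 i), ?_, ?_⟩
    · intro l
      ext i
      · simp only; linear_combination (l.1 i) * h
      · simp only; linear_combination (l.2 i) * h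
    · intro l
      ext i
      · simp only; linear_combination (l.1 i) * h
      · simp only; linear_combination (l.2 i) * h
  have hDm := measurableSet_torusDomain (g := g)
  -- The image of the fundamental domain under `L` is again one, which gives the claim up to the
  -- factor `c`; constant functions show that `c = 1`.
  have main : ∀ f : (Fin g → ℝ) × (Fin g → ℝ) → ℝ≥0∞, Measurable f → TorusPeriodic f →
      ∫⁻ x in torusDomain g, f (L x) = c * ∫⁻ x in torusDomain g, f x := by
    intro f hfm hf
    have hind : Measurable fun y => (torusDomain g).indicator (fun _ => (1 : ℝ≥0∞)) (L.symm y) :=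
      (measurable_const.indicator hDm).comp hLsm
    calc ∫⁻ x in torusDomain g, f (L x)
        = ∫⁻ x, (torusDomain g).indicator (fun _ => (1 : ℝ≥0∞)) (L.symm (L x)) * f (L x) := by
          rw [← lintegral_indicator hDm]
          refine lintegral_congr fun x => ?_
          rw [L.symm_apply_apply]
          by_cases hx : x ∈ torusDomain g <;> simp [hx]
      _ = ∫⁻ y, (torusDomain g).indicator (fun _ => (1 : ℝ≥0∞)) (L.symm y) * f y
            ∂(Measure.map L volume) := by
          exact (lintegral_map (hind.mul hfm) hLm).symm
      _ = c * ∫⁻ y, (torusDomain g).indicator (fun _ => (1 : ℝ≥0∞)) (L.symm y) * f y := by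
          rw [hc, lintegral_smul_measure, smul_eq_mul]
      _ = c * ∑' l, ∫⁻ x in torusDomain g,
            (torusDomain g).indicator (fun _ => (1 : ℝ≥0∞)) (L.symm (x + latticeVec l)) * f x := by
          rw [lintegral_eq_tsum_of_floor latticeVec floorPair measurable_floorPair floorPair_add,
            floorPair_preimage_zero]
          congr 1
          refine tsum_congr fun l => lintegral_congr fun x => ?_
          congr 1
          exact hf l.1 l.2 x.1 x.2
      _ = c * ∫⁻ x in torusDomain g, f x := by
          rw [← lintegral_tsum]
          · congr 1
            refine lintegral_congr fun x => ?_
            rw [ENNReal.tsum_mul_right]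
            have hsum := (Equiv.ofBijective _ hbij).tsum_eq
              (fun l => (torusDomain g).indicator (fun _ => (1 : ℝ≥0∞)) (L.symm x + latticeVec l))
            rw [tsum_indicator_torusDomain] at hsum
            refine Eq.trans ?_ (one_mul _)
            refine congrArg (· * f x) (Eq.trans ?_ hsum)
            exact tsum_congr fun l => by rw [hsymm]; rfl
          · intro l
            exact ((hind.comp (measurable_id.add_const _)).mul hfm).aemeasurable
  have h1 := main (fun _ => 1) measurable_const (fun _ _ _ _ => rfl)
  simp only [lintegral_const, Measure.restrict_apply MeasurableSet.univ, Set.univ_inter,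
    volume_torusDomain, mul_one] at h1
  rw [main f hfm hf, ← h1, one_mul]

end Unfolding

/-! ### Gaussian integrals and lattice sums -/

section Gaussian

open scoped ENNReal

variable {g : ℕ} {m : Matrix (Fin g) (Fin g) ℝ}

theorem dotProduct_mulVec_comm (hs : m.IsSymm) (x y : Fin g → ℝ) :
    x ⬝ᵥ m.mulVec y = y ⬝ᵥ m.mulVec x := by
  rw [Matrix.dotProduct_mulVec, ← Matrix.mulVec_transpose, hs.eq, dotProduct_comm]

theorem dotProduct_mulVec_add_self (hs : m.IsSymm) (x y : Fin g → ℝ) :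
    (x + y) ⬝ᵥ m.mulVec (x + y)
      = x ⬝ᵥ m.mulVec x + 2 * (x ⬝ᵥ m.mulVec y) + y ⬝ᵥ m.mulVec y := by
  rw [Matrix.mulVec_add, add_dotProduct, dotProduct_add, dotProduct_add,
    dotProduct_mulVec_comm hs y x]
  ring

theorem dotProduct_mulVec_self_nonneg (hm : m.PosDef) (x : Fin g → ℝ) :
    0 ≤ x ⬝ᵥ m.mulVec x := by
  simpa using hm.posSemidef.dotProduct_mulVec_nonneg x

theorem continuous_dotProduct_mulVec :
    Continuous fun x : Fin g → ℝ => x ⬝ᵥ m.mulVec x := by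
  unfold dotProduct Matrix.mulVec dotProduct
  fun_prop

theorem exists_pos_mul_sum_sq_le (hm : m.PosDef) :
    ∃ ε : ℝ, 0 < ε ∧ ∀ x : Fin g → ℝ, ε * ∑ i, x i ^ 2 ≤ x ⬝ᵥ m.mulVec x := by
  rcases Set.eq_empty_or_nonempty {x : Fin g → ℝ | ∑ i, x i ^ 2 = 1} with he | hne
  · refine ⟨1, one_pos, fun x => ?_⟩
    have hx : ∑ i, x i ^ 2 = 0 := by
      by_contra h
      have hpos : 0 < ∑ i, x i ^ 2 := lt_of_le_of_ne (by positivity) (Ne.symm h)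
      have : (Real.sqrt (∑ i, x i ^ 2))⁻¹ • x ∈ ({x : Fin g → ℝ | ∑ i, x i ^ 2 = 1}) := by
        simp only [Set.mem_ofPred_eq, Pi.smul_apply, smul_eq_mul, mul_pow, ← Finset.mul_sum,
          inv_pow, Real.sq_sqrt hpos.le]
        exact inv_mul_cancel₀ hpos.ne'
      rw [he] at this
      exact this
    rw [hx, mul_zero]
    exact dotProduct_mulVec_self_nonneg hm x
  · have hcomp : IsCompact {x : Fin g → ℝ | ∑ i, x i ^ 2 = 1} := by
      refine Metric.isCompact_of_isClosed_isBounded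
        (isClosed_eq (by fun_prop) continuous_const) ?_
      refine (Metric.isBounded_closedBall (x := (0 : Fin g → ℝ)) (r := 1)).subset fun x hx => ?_
      rw [mem_closedBall_zero_iff, pi_norm_le_iff_of_nonneg zero_le_one]
      intro i
      have h1 : x i ^ 2 ≤ 1 := by
        rw [← (hx : ∑ i, x i ^ 2 = 1)]
        exact Finset.single_le_sum (f := fun i => x i ^ 2) (fun i _ => sq_nonneg _)
          (Finset.mem_univ i)
      rw [Real.norm_eq_abs]
      exact abs_le_one_iff_mul_self_le_one.2 (by nlinarith)
    obtain ⟨x0, hx0, hmin⟩ := hcomp.exists_isMinOn hne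
      (continuous_dotProduct_mulVec (m := m)).continuousOn
    have hx0ne : x0 ≠ 0 := by
      rintro rfl
      simp at hx0
    refine ⟨x0 ⬝ᵥ m.mulVec x0, by simpa using hm.dotProduct_mulVec_pos hx0ne, fun x => ?_⟩
    by_cases h : ∑ i, x i ^ 2 = 0
    · rw [h, mul_zero]
      exact dotProduct_mulVec_self_nonneg hm x
    · have hpos : 0 < ∑ i, x i ^ 2 := lt_of_le_of_ne (by positivity) (Ne.symm h)
      set s := Real.sqrt (∑ i, x i ^ 2) with hs
      have hs2 : s ^ 2 = ∑ i, x i ^ 2 := Real.sq_sqrt hpos.le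
      have hspos : 0 < s := Real.sqrt_pos.2 hpos
      have hmem : s⁻¹ • x ∈ ({x : Fin g → ℝ | ∑ i, x i ^ 2 = 1}) := by
        simp only [Set.mem_ofPred_eq, Pi.smul_apply, smul_eq_mul, mul_pow, ← Finset.mul_sum,
          inv_pow, hs2]
        exact inv_mul_cancel₀ hpos.ne'
      have := hmin hmem
      simp only [Set.mem_ofPred_eq, Matrix.mulVec_smul, smul_dotProduct, dotProduct_smul,
        smul_eq_mul] at this
      rw [← hs2]
      calc x0 ⬝ᵥ m.mulVec x0 * s ^ 2 ≤ (s⁻¹ * (s⁻¹ * x ⬝ᵥ m.mulVec x)) * s ^ 2 := by gcongr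
        _ = x ⬝ᵥ m.mulVec x := by field_simp

/-- The Gaussian integral `∫ exp(-m[p]) dp`. -/
noncomputable def gaussConst (m : Matrix (Fin g) (Fin g) ℝ) : ℝ≥0∞ :=
  ∫⁻ p : Fin g → ℝ, ENNReal.ofReal (Real.exp (-(p ⬝ᵥ m.mulVec p)))

theorem gaussConst_ne_top (hm : m.PosDef) : gaussConst m ≠ ∞ := by
  obtain ⟨ε, hε, h⟩ := exists_pos_mul_sum_sq_le hm
  have hint : Integrable (fun p : Fin g → ℝ => ∏ i, Real.exp (-ε * p i ^ 2)) volume :=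
    Integrable.fintype_prod fun _ => integrable_exp_neg_mul_sq hε
  refine ne_top_of_le_ne_top hint.lintegral_lt_top.ne (lintegral_mono fun p => ?_)
  refine ENNReal.ofReal_le_ofReal ?_
  rw [← Real.exp_sum, Real.exp_le_exp, ← Finset.mul_sum]
  linarith [h p]

theorem gaussConst_ne_zero : gaussConst m ≠ 0 := by
  intro h0
  unfold gaussConst at h0
  have hmeas : Measurable fun p : Fin g → ℝ => ENNReal.ofReal (Real.exp (-(p ⬝ᵥ m.mulVec p))) :=
    continuous_dotProduct_mulVec.neg.rexp.measurable.ennreal_ofReal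
  rw [lintegral_eq_zero_iff hmeas] at h0
  obtain ⟨p, hp⟩ := h0.exists
  simp only [Pi.zero_apply, ENNReal.ofReal_eq_zero] at hp
  exact absurd hp (not_le.2 (Real.exp_pos _))

theorem lintegral_exp_neg_mul_dotProduct_mulVec {t : ℝ} (ht : 0 < t) :
    ∫⁻ p : Fin g → ℝ, ENNReal.ofReal (Real.exp (-(t * (p ⬝ᵥ m.mulVec p))))
      = ENNReal.ofReal ((Real.sqrt t ^ g)⁻¹) * gaussConst m := by
  have hst : 0 < Real.sqrt t := Real.sqrt_pos.2 ht
  have hmap := Measure.map_addHaar_smul (volume : Measure (Fin g → ℝ)) hst.ne'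
  have hmeas : Measurable fun p : Fin g → ℝ => ENNReal.ofReal (Real.exp (-(p ⬝ᵥ m.mulVec p))) :=
    continuous_dotProduct_mulVec.neg.rexp.measurable.ennreal_ofReal
  have := lintegral_map (μ := (volume : Measure (Fin g → ℝ))) hmeas
    (measurable_const_smul (Real.sqrt t))
  rw [hmap, lintegral_smul_measure] at this
  rw [gaussConst, ← abs_of_pos (inv_pos.2 (pow_pos hst g))]
  simp only [Module.finrank_fintype_fun_eq_card, Fintype.card_fin, smul_eq_mul] at this
  rw [this]
  refine lintegral_congr fun p => ?_
  simp only [Matrix.mulVec_smul, smul_dotProduct, dotProduct_smul, smul_eq_mul, ← mul_assoc,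
    Real.mul_self_sqrt ht.le]

variable {n : ℕ} {r : Fin g → ℤ}

/-- The number `n - m⁻¹[rᵗ] / 4`, the minimum of `quadPoly` on `ℝ^g`. -/
noncomputable def quadMin (m : Matrix (Fin g) (Fin g) ℝ) (n : ℕ) (r : Fin g → ℤ) : ℝ :=
  n - (fun i => (r i : ℝ)) ⬝ᵥ (m⁻¹.mulVec fun i => (r i : ℝ)) / 4

/-- The point `m⁻¹ rᵗ / 2`; the minimum of `quadPoly` is attained at its negative. -/
noncomputable def quadCenter (m : Matrix (Fin g) (Fin g) ℝ) (r : Fin g → ℤ) : Fin g → ℝ :=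
  (1 / 2 : ℝ) • m⁻¹.mulVec fun i => (r i : ℝ)

theorem quadPoly_eq (hs : m.IsSymm) (hm : m.PosDef) (p : Fin g → ℝ) :
    quadPoly m n r p = (p + quadCenter m r) ⬝ᵥ m.mulVec (p + quadCenter m r) + quadMin m n r := by
  have hu : IsUnit m.det := hm.det_pos.ne'.isUnit
  have h1 : m.mulVec (quadCenter m r) = (1 / 2 : ℝ) • fun i => (r i : ℝ) := by
    rw [quadCenter, Matrix.mulVec_smul, Matrix.mulVec_mulVec, Matrix.mul_nonsing_inv _ hu,
      Matrix.one_mulVec]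
  rw [dotProduct_mulVec_add_self hs, h1, quadPoly, quadMin, quadCenter]
  simp only [dotProduct_smul, smul_dotProduct, smul_eq_mul]
  rw [dotProduct_comm (m⁻¹.mulVec fun i => (r i : ℝ))]
  have : (∑ i, (r i : ℝ) * p i) = p ⬝ᵥ fun i => (r i : ℝ) := by
    simp [dotProduct, mul_comm]
  rw [this]
  ring

theorem continuous_quadPoly : Continuous (quadPoly m n r) := by
  unfold quadPoly
  exact (continuous_dotProduct_mulVec.add (by fun_prop)).add continuous_const

/-- The integral `∫ exp(-t N(p)) dp`. -/
theorem lintegral_exp_neg_mul_quadPoly (hs : m.IsSymm) (hm : m.PosDef) {t : ℝ} (ht : 0 < t) :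
    ∫⁻ p : Fin g → ℝ, ENNReal.ofReal (Real.exp (-(t * quadPoly m n r p)))
      = ENNReal.ofReal (Real.exp (-(t * quadMin m n r)) * (Real.sqrt t ^ g)⁻¹) * gaussConst m := by
  rw [ENNReal.ofReal_mul (Real.exp_pos _).le, mul_assoc,
    ← lintegral_exp_neg_mul_dotProduct_mulVec ht,
    ← lintegral_const_mul' _ _ ENNReal.ofReal_ne_top,
    ← lintegral_add_right_eq_self
      (fun p => _ * ENNReal.ofReal (Real.exp (-(t * (p ⬝ᵥ m.mulVec p))))) (quadCenter m r)]
  refine lintegral_congr fun p => ?_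
  rw [← ENNReal.ofReal_mul (Real.exp_pos _).le, ← Real.exp_add, quadPoly_eq hs hm]
  congr 2
  ring

/-- The lattice sum is bounded by a Gaussian integral, because `exp(-t N)` at a point is bounded
by a multiple of `exp(-t N / 2)` at all points of a unit cube next to it. -/
theorem exists_tsum_exp_neg_quadPoly_le (hs : m.IsSymm) (hm : m.PosDef) (n : ℕ) (r : Fin g → ℤ) :
    ∃ C : ℝ, ∀ t : ℝ, 0 < t → ∀ p : Fin g → ℝ,
      ∑' l : Fin g → ℤ, ENNReal.ofReal (Real.exp (-(t * quadPoly m n r (fun i => p i + l i))))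
        ≤ ENNReal.ofReal (Real.exp (t * C)) *
          ∫⁻ p : Fin g → ℝ, ENNReal.ofReal (Real.exp (-(t / 2 * quadPoly m n r p))) := by
  refine ⟨(∑ i, ∑ j, |m i j|) + |quadMin m n r|, fun t ht p => ?_⟩
  set C := (∑ i, ∑ j, |m i j|) + |quadMin m n r| with hC
  rw [← lintegral_add_left_eq_self _ p, lintegral_eq_tsum_unitCube, ← ENNReal.tsum_mul_left]
  refine ENNReal.tsum_le_tsum fun l => ?_
  rw [← lintegral_const_mul' _ _ ENNReal.ofReal_ne_top]
  have hkey : ∀ x ∈ unitCube g, quadPoly m n r (p + fun i => x i + l i) / 2 - C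
      ≤ quadPoly m n r (fun i => p i + l i) := by
    intro x hx
    have hxC : x ⬝ᵥ m.mulVec x ≤ ∑ i, ∑ j, |m i j| := by
      simp only [dotProduct, Matrix.mulVec, Finset.mul_sum]
      refine Finset.sum_le_sum fun i _ => Finset.sum_le_sum fun j _ => ?_
      have hi := hx i (Set.mem_univ i)
      have hj := hx j (Set.mem_univ j)
      calc x i * (m i j * x j) ≤ |x i * (m i j * x j)| := le_abs_self _
        _ = x i * x j * |m i j| := by
          rw [abs_mul, abs_mul, abs_of_nonneg hi.1, abs_of_nonneg hj.1]; ring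
        _ ≤ 1 * 1 * |m i j| := by
          exact mul_le_mul_of_nonneg_right (mul_le_mul hi.2.le hj.2.le hj.1 zero_le_one)
            (abs_nonneg _)
        _ = |m i j| := by ring
    set y : Fin g → ℝ := (fun i => p i + l i) + quadCenter m r with hy
    have e1 : (p + fun i => x i + l i) + quadCenter m r = y + x := by
      ext i; simp [hy]; ring
    rw [quadPoly_eq hs hm, quadPoly_eq hs hm, e1, dotProduct_mulVec_add_self hs]
    -- the parallelogram law gives `m[y + x] ≤ 2 m[y] + 2 m[x]`
    have hnn := dotProduct_mulVec_self_nonneg hm (y + (-1 : ℝ) • x)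
    rw [dotProduct_mulVec_add_self hs] at hnn
    simp only [Matrix.mulVec_smul, smul_dotProduct, dotProduct_smul, smul_eq_mul] at hnn
    have := neg_abs_le (quadMin m n r)
    linarith [le_abs_self (quadMin m n r)]
  calc ENNReal.ofReal (Real.exp (-(t * quadPoly m n r fun i => p i + l i)))
      = ∫⁻ _ in unitCube g, ENNReal.ofReal (Real.exp (-(t * quadPoly m n r fun i => p i + l i))) := by
        rw [setLIntegral_const, volume_unitCube, mul_one]
    _ ≤ _ := by
        refine setLIntegral_mono' measurableSet_unitCube fun x hx => ?_
        rw [← ENNReal.ofReal_mul (Real.exp_pos _).le, ← Real.exp_add]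
        refine ENNReal.ofReal_le_ofReal (Real.exp_le_exp.2 ?_)
        nlinarith [hkey x hx]

end Gaussian

/-! ### Fourier orthogonality on the unit cube -/

section Fourier

open scoped ComplexConjugate

variable {g : ℕ}

theorem norm_expTwoPiI (w : ℂ) : ‖expTwoPiI w‖ = Real.exp (-(2 * Real.pi * w.im)) := by
  unfold expTwoPiI
  rw [Complex.norm_exp]
  congr 1
  simp

theorem norm_expTwoPiI_ofReal (x : ℝ) : ‖expTwoPiI x‖ = 1 := by
  simp [norm_expTwoPiI]

theorem expTwoPiI_add (w w' : ℂ) : expTwoPiI (w + w') = expTwoPiI w * expTwoPiI w' := by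
  unfold expTwoPiI
  rw [← Complex.exp_add, mul_add]

theorem expTwoPiI_sum {ι : Type*} (s : Finset ι) (w : ι → ℂ) :
    expTwoPiI (∑ i ∈ s, w i) = ∏ i ∈ s, expTwoPiI (w i) := by
  unfold expTwoPiI
  rw [Finset.mul_sum, Complex.exp_sum]

theorem continuous_expTwoPiI : Continuous expTwoPiI := by
  unfold expTwoPiI
  fun_prop

theorem conj_expTwoPiI (w : ℂ) : conj (expTwoPiI w) = expTwoPiI (-conj w) := by
  unfold expTwoPiI
  rw [← Complex.exp_conj]
  congr 1
  simp [map_ofNat (starRingEnd ℂ) 2]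

/-- The character `q ↦ e(ν q)` of `ℝ^g`. -/
noncomputable def fourierChar (ν : Fin g → ℤ) (q : Fin g → ℝ) : ℂ :=
  expTwoPiI (∑ i, (ν i : ℂ) * q i)

theorem norm_fourierChar (ν : Fin g → ℤ) (q : Fin g → ℝ) : ‖fourierChar ν q‖ = 1 := by
  have := norm_expTwoPiI_ofReal (∑ i, (ν i : ℝ) * q i)
  push_cast at this
  exact this

theorem continuous_fourierChar (ν : Fin g → ℤ) : Continuous (fourierChar ν) := by
  unfold fourierChar
  exact continuous_expTwoPiI.comp (by fun_prop)

theorem fourierChar_mul_conj (ν ν' : Fin g → ℤ) (q : Fin g → ℝ) :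
    fourierChar ν q * conj (fourierChar ν' q) = fourierChar (ν - ν') q := by
  unfold fourierChar
  rw [conj_expTwoPiI, ← expTwoPiI_add]
  congr 1
  rw [map_sum, ← Finset.sum_neg_distrib, ← Finset.sum_add_distrib]
  refine Finset.sum_congr rfl fun i _ => ?_
  simp
  ring

theorem integral_expTwoPiI_intCast_mul (a : ℤ) :
    ∫ x : ℝ in Set.Ico 0 1, expTwoPiI (a * x) = if a = 0 then 1 else 0 := by
  rw [integral_Ico_eq_integral_Ioc, ← intervalIntegral.integral_of_le zero_le_one]
  split_ifs with h
  · simp [h, expTwoPiI]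
  · have hc : 2 * (Real.pi : ℂ) * Complex.I * a ≠ 0 := by
      simp [Real.pi_ne_zero, h]
    have := integral_exp_mul_complex (a := 0) (b := 1) hc
    unfold expTwoPiI
    simp_rw [← mul_assoc]
    rw [this]
    have h1 : Complex.exp (2 * (Real.pi : ℂ) * Complex.I * a * (1 : ℝ)) = 1 := by
      rw [Complex.exp_eq_one_iff]
      exact ⟨a, by push_cast; ring⟩
    rw [h1]
    simp

theorem integral_fourierChar (ν : Fin g → ℤ) :
    ∫ q in unitCube g, fourierChar ν q = if ν = 0 then 1 else 0 := by
  unfold fourierChar unitCube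
  simp_rw [expTwoPiI_sum]
  rw [volume_pi, Measure.restrict_pi_pi,
    integral_fintype_prod_eq_prod (fun i (x : ℝ) => expTwoPiI ((ν i : ℂ) * x))]
  simp_rw [integral_expTwoPiI_intCast_mul]
  split_ifs with h
  · simp [h]
  · obtain ⟨i, hi⟩ := Function.ne_iff.1 h
    exact Finset.prod_eq_zero (Finset.mem_univ i) (by simpa using hi)

/-- Parseval's formula for absolutely convergent Fourier series. -/
theorem integral_tsum_fourierChar_mul_conj {ι : Type*} [Countable ι] {a b : ι → ℂ}
    (ha : Summable fun i => ‖a i‖) (hb : Summable fun i => ‖b i‖) (α β : ι → Fin g → ℤ) :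
    ∫ q in unitCube g, (∑' i, a i * fourierChar (α i) q)
        * conj (∑' i, b i * fourierChar (β i) q)
      = ∑' x : ι × ι, a x.1 * conj (b x.2) * if α x.1 = β x.2 then 1 else 0 := by
  have h1 : ∀ q, (∑' i, a i * fourierChar (α i) q) * conj (∑' i, b i * fourierChar (β i) q)
      = ∑' x : ι × ι, a x.1 * conj (b x.2) * fourierChar (α x.1 - β x.2) q := by
    intro q
    rw [Complex.conj_tsum, tsum_mul_tsum_of_summable_norm]
    · refine tsum_congr fun x => ?_
      rw [map_mul, ← fourierChar_mul_conj]
      ring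
    · simpa [norm_fourierChar] using ha
    · simpa [norm_fourierChar] using hb
  have hint : ∀ ν : Fin g → ℤ, Integrable (fourierChar ν) (volume.restrict (unitCube g)) := by
    intro ν
    refine Integrable.of_bound (continuous_fourierChar ν).aestronglyMeasurable 1
      (Eventually.of_forall fun q => (norm_fourierChar ν q).le)
  simp_rw [h1]
  rw [← integral_tsum_of_summable_integral_norm]
  · refine tsum_congr fun x => ?_
    rw [integral_const_mul, integral_fourierChar]
    simp [sub_eq_zero]
  · exact fun x => (hint _).const_mul _
  · simp only [norm_mul, norm_fourierChar, mul_one, RCLike.norm_conj, integral_const,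
      smul_eq_mul, probReal_univ, one_mul]
    exact ha.mul_of_nonneg hb (fun _ => norm_nonneg _) (fun _ => norm_nonneg _)

end Fourier

/-! ### The theta function -/

section Theta

open scoped ComplexConjugate ENNReal

variable {g : ℕ} {m : Matrix (Fin g) (Fin g) ℝ} {n : ℕ} {r : Fin g → ℤ}

theorem quadMin_pos (h : (fun i => (r i : ℝ)) ⬝ᵥ (m⁻¹.mulVec fun i => (r i : ℝ)) < 4 * (n : ℝ)) :
    0 < quadMin m n r := by
  unfold quadMin; linarith

theorem jacobiBilin_ofReal_intCast (x : Fin g → ℤ) (y : Fin g → ℝ) :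
    jacobiBilin m (fun i => (x i : ℂ)) (fun i => (y i : ℂ))
      = (((fun i => (x i : ℝ)) ⬝ᵥ m.mulVec y : ℝ) : ℂ) := by
  rw [ofReal_dotProduct_mulVec]
  simp

theorem norm_thetaTerm (l : Fin g → ℤ) (τ : ℍ) (p q : Fin g → ℝ) :
    ‖thetaTerm m n r l τ p q‖
      = Real.exp (-(2 * Real.pi * τ.im * quadPoly m n r fun i => p i + l i)) := by
  unfold thetaTerm
  rw [norm_expTwoPiI, jacobiBilin_ofReal_intCast, ← ofReal_dotProduct_mulVec]
  congr 2
  have : (∑ i, (r i : ℂ) * (q i : ℂ)) = ((∑ i, (r i : ℝ) * q i : ℝ) : ℂ) := by push_cast; rfl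
  rw [this]
  simp only [Complex.add_im, Complex.mul_im, Complex.ofReal_re, Complex.ofReal_im, zero_mul,
    add_zero, UpperHalfPlane.coe_im]
  simp
  ring

/-- The theta function attached to `(n, r)` in the coordinates `(p, q)`. -/
noncomputable def theta (m : Matrix (Fin g) (Fin g) ℝ) (n : ℕ) (r : Fin g → ℤ) (τ : ℍ)
    (x : (Fin g → ℝ) × (Fin g → ℝ)) : ℂ :=
  ∑' l, thetaTerm m n r l τ x.1 x.2

/-- The theta series converges absolutely, with a bound uniform in `(p, q)` and explicit in
the imaginary part of `τ`. -/
theorem exists_tsum_norm_thetaTerm_le (hs : m.IsSymm) (hm : m.PosDef) (hD : 0 < quadMin m n r) :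
    ∃ K C : ℝ, 0 ≤ K ∧ 0 ≤ C ∧ ∀ (τ : ℍ) (p q : Fin g → ℝ),
      (Summable fun l => ‖thetaTerm m n r l τ p q‖) ∧
      ∑' l, ‖thetaTerm m n r l τ p q‖ ≤ K * Real.exp (C * τ.im) * (Real.sqrt τ.im ^ g)⁻¹ := by
  obtain ⟨C, hC⟩ := exists_tsum_exp_neg_quadPoly_le hs hm n r
  refine ⟨(gaussConst m).toReal, 2 * Real.pi * |C|, ENNReal.toReal_nonneg, by positivity,
    fun τ p q => ?_⟩
  have hv : 0 < τ.im := τ.im_pos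
  have ht : 0 < 2 * Real.pi * τ.im := by positivity
  have h1 := hC _ ht p
  rw [lintegral_exp_neg_mul_quadPoly hs hm (by positivity)] at h1
  have h2 : ∑' l, ENNReal.ofReal ‖thetaTerm m n r l τ p q‖ ≤ ENNReal.ofReal
      ((gaussConst m).toReal * Real.exp (2 * Real.pi * |C| * τ.im) * (Real.sqrt τ.im ^ g)⁻¹) := by
    simp_rw [norm_thetaTerm]
    refine h1.trans ?_
    have e0 : (gaussConst m).toReal * Real.exp (2 * Real.pi * |C| * τ.im) * (Real.sqrt τ.im ^ g)⁻¹
        = Real.exp (2 * Real.pi * |C| * τ.im) * (Real.sqrt τ.im ^ g)⁻¹ * (gaussConst m).toReal := by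
      ring
    rw [e0, ENNReal.ofReal_mul (q := (gaussConst m).toReal) (by positivity),
      ENNReal.ofReal_toReal (gaussConst_ne_top hm), ← mul_assoc]
    refine mul_le_mul_left ?_ _
    rw [← ENNReal.ofReal_mul (by positivity)]
    refine ENNReal.ofReal_le_ofReal ?_
    have e1 : Real.exp (2 * Real.pi * τ.im * C) ≤ Real.exp (2 * Real.pi * |C| * τ.im) := by
      refine Real.exp_le_exp.2 ?_
      have := le_abs_self C
      nlinarith
    have e2 : Real.exp (-(2 * Real.pi * τ.im / 2 * quadMin m n r)) ≤ 1 :=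
      Real.exp_le_one_iff.2 (by simp only [Left.neg_nonpos_iff]; positivity)
    have e3 : (Real.sqrt (2 * Real.pi * τ.im / 2) ^ g)⁻¹ ≤ (Real.sqrt τ.im ^ g)⁻¹ := by
      have : 0 < Real.sqrt τ.im := Real.sqrt_pos.2 hv
      gcongr
      nlinarith [Real.pi_gt_three]
    calc _ ≤ Real.exp (2 * Real.pi * |C| * τ.im) * (1 * (Real.sqrt τ.im ^ g)⁻¹) := by gcongr
      _ = _ := by ring
  have hsum : Summable fun l => ‖thetaTerm m n r l τ p q‖ := by
    have := ENNReal.summable_toReal (ne_top_of_le_ne_top ENNReal.ofReal_ne_top h2)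
    simpa using this
  refine ⟨hsum, ?_⟩
  rw [← ENNReal.ofReal_tsum_of_nonneg (fun _ => norm_nonneg _) hsum] at h2
  exact (ENNReal.ofReal_le_ofReal_iff (by positivity)).1 h2

/-- The frequency `r + 2 lᵗ m` of a theta summand in the variable `q`. -/
theorem exists_thetaFreq (hm : IsHalfIntegral m) (r : Fin g → ℤ) :
    ∃ ω : (Fin g → ℤ) → (Fin g → ℤ), ∀ l j,
      (ω l j : ℝ) = r j + ∑ i, (l i : ℝ) * (2 * m i j) := by
  choose A hA using hm.offDiag
  refine ⟨fun l j => r j + ∑ i, l i * A i j, fun l j => ?_⟩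
  push_cast
  simp_rw [hA]

theorem thetaFreq_injective (hm : m.PosDef) {ω : (Fin g → ℤ) → (Fin g → ℤ)}
    (hω : ∀ l j, (ω l j : ℝ) = r j + ∑ i, (l i : ℝ) * (2 * m i j)) : Function.Injective ω := by
  intro l l' h
  have h0 : Matrix.vecMul (fun i => ((l i : ℝ) - l' i)) m = 0 := by
    ext j
    have h1 := hω l j
    rw [h, hω l' j] at h1
    simp only [Matrix.vecMul, dotProduct, sub_mul, Finset.sum_sub_distrib, Pi.zero_apply]
    have e : ∀ l : Fin g → ℤ, ∑ i, (l i : ℝ) * (2 * m i j) = 2 * ∑ i, (l i : ℝ) * m i j := by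
      intro l
      rw [Finset.mul_sum]
      exact Finset.sum_congr rfl fun i _ => by ring
    rw [e, e] at h1
    linarith
  have h2 := Matrix.eq_zero_of_vecMul_eq_zero hm.det_pos.ne' h0
  ext i
  have := congrFun h2 i
  simp only [Pi.zero_apply, sub_eq_zero] at this
  exact_mod_cast this

theorem thetaTerm_eq_mul_fourierChar {ω : (Fin g → ℤ) → (Fin g → ℤ)}
    (hω : ∀ l j, (ω l j : ℝ) = r j + ∑ i, (l i : ℝ) * (2 * m i j))
    (l : Fin g → ℤ) (τ : ℍ) (p q : Fin g → ℝ) :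
    thetaTerm m n r l τ p q
      = expTwoPiI ((p ⬝ᵥ m.mulVec q : ℝ) : ℂ) *
        (expTwoPiI ((quadPoly m n r (fun i => p i + l i) : ℂ) * τ) * fourierChar (ω l) q) := by
  unfold thetaTerm fourierChar
  rw [← expTwoPiI_add, ← expTwoPiI_add, ofReal_dotProduct_mulVec]
  have : (∑ i, (ω l i : ℂ) * q i) = (∑ i, (r i : ℂ) * q i)
      + 2 * jacobiBilin m (fun i => (l i : ℂ)) (fun i => (q i : ℂ)) := by
    have hω' : ∀ j, (ω l j : ℂ) = r j + ∑ i, (l i : ℂ) * (2 * m i j) := fun j => by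
      exact_mod_cast congrArg (fun x : ℝ => (x : ℂ)) (hω l j)
    simp only [hω', add_mul, Finset.sum_add_distrib, jacobiBilin, Finset.mul_sum,
      Finset.sum_mul]
    congr 1
    rw [Finset.sum_comm]
    exact Finset.sum_congr rfl fun i _ => Finset.sum_congr rfl fun j _ => by ring
  rw [this]
  congr 1
  ring

theorem theta_eq_mul_tsum {ω : (Fin g → ℤ) → (Fin g → ℤ)}
    (hω : ∀ l j, (ω l j : ℝ) = r j + ∑ i, (l i : ℝ) * (2 * m i j))
    (τ : ℍ) (p q : Fin g → ℝ) :
    theta m n r τ (p, q) = expTwoPiI ((p ⬝ᵥ m.mulVec q : ℝ) : ℂ) *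
      ∑' l, expTwoPiI ((quadPoly m n r (fun i => p i + l i) : ℂ) * τ) * fourierChar (ω l) q := by
  simp only [theta, thetaTerm_eq_mul_fourierChar hω, tsum_mul_left]

theorem measurable_theta (τ : ℍ) : Measurable (theta m n r τ) := by
  refine Measurable.tsum fun l => Continuous.measurable ?_
  unfold thetaTerm
  refine continuous_expTwoPiI.comp ?_
  refine ((Continuous.mul ?_ continuous_const).add ?_).add ?_
  · exact Complex.continuous_ofReal.comp (continuous_quadPoly.comp (by fun_prop))
  · unfold jacobiBilin; fun_prop
  · unfold jacobiBilin; fun_prop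

theorem norm_expTwoPiI_quadPoly_mul (l : Fin g → ℤ) (τ : ℍ) (p : Fin g → ℝ) :
    ‖expTwoPiI ((quadPoly m n r (fun i => p i + l i) : ℂ) * τ)‖
      = Real.exp (-(2 * Real.pi * τ.im * quadPoly m n r fun i => p i + l i)) := by
  rw [norm_expTwoPiI, Complex.im_ofReal_mul, UpperHalfPlane.coe_im]
  congr 2
  ring

theorem thetaTerm_add (hmi : IsHalfIntegral m) (l a b : Fin g → ℤ) (τ : ℍ) (p q : Fin g → ℝ) :
    thetaTerm m n r l τ (fun i => p i + a i) (fun i => q i + b i)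
      = expTwoPiI ((p ⬝ᵥ m.mulVec (fun i => (b i : ℝ)) - (fun i => (a i : ℝ)) ⬝ᵥ m.mulVec q
          + (fun i => (a i : ℝ)) ⬝ᵥ m.mulVec (fun i => (b i : ℝ)) : ℝ) : ℂ)
        * thetaTerm m n r (a + l) τ p q := by
  obtain ⟨e, he⟩ := two_mul_jacobiBilin_int hmi l b
  unfold thetaTerm
  rw [← expTwoPiI_add, ← expTwoPiI_add_int (_ + _) (-(∑ i, r i * b i) - e),
    Int.cast_sub _ e, ← he]
  congr 1
  have h1 : (fun i => ((p i + a i : ℝ) : ℂ)) = (fun i => (p i : ℂ)) + fun i => (a i : ℂ) := by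
    ext i; simp
  have h2 : (fun i => ((q i + b i : ℝ) : ℂ)) = (fun i => (q i : ℂ)) + fun i => (b i : ℂ) := by
    ext i; simp
  have h3 : (fun i => (((a + l) i : ℤ) : ℂ)) = (fun i => (a i : ℂ)) + fun i => (l i : ℂ) := by
    ext i; simp
  have h4 : (fun i => p i + ((a + l) i : ℤ)) = fun i => p i + (a i : ℝ) + (l i : ℝ) := by
    ext i; simp; ring
  rw [h1, h2, h3, h4]
  push_cast
  rw [ofReal_dotProduct_mulVec, ofReal_dotProduct_mulVec, ofReal_dotProduct_mulVec]
  simp only [jacobiBilin_add_left, jacobiBilin_add_right, mul_add, Finset.sum_add_distrib,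
    Complex.ofReal_intCast]
  ring

/-- The absolute value of theta is a function on the torus. -/
theorem torusPeriodic_norm_theta (hmi : IsHalfIntegral m) (τ : ℍ) :
    TorusPeriodic fun x => ‖theta m n r τ x‖ₑ := by
  intro a b p q
  have hshift := (Equiv.addLeft a).tsum_eq (fun l => thetaTerm m n r l τ p q)
  simp only [Equiv.coe_addLeft] at hshift
  simp only [theta, thetaTerm_add hmi, tsum_mul_left]
  rw [enorm_mul, hshift]
  have : ∀ x : ℝ, ‖expTwoPiI x‖ₑ = 1 := fun x => by
    rw [← ofReal_norm, norm_expTwoPiI_ofReal, ENNReal.ofReal_one]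
  rw [this, one_mul]

/-- The square of the norm of theta on the torus. -/
theorem setLIntegral_enorm_theta_sq (hmi : IsHalfIntegral m) (hm : m.PosDef)
    (hD : 0 < quadMin m n r) (τ : ℍ) :
    ∫⁻ x in torusDomain g, ‖theta m n r τ x‖ₑ ^ 2
      = ENNReal.ofReal (Real.exp (-(4 * Real.pi * τ.im * quadMin m n r))
          * (Real.sqrt (4 * Real.pi * τ.im) ^ g)⁻¹) * gaussConst m := by
  obtain ⟨ω, hω⟩ := exists_thetaFreq hmi r
  obtain ⟨K, C, -, -, hKC⟩ := exists_tsum_norm_thetaTerm_le hmi.isSymm hm hD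
  have hv : 0 < τ.im := τ.im_pos
  rw [← lintegral_exp_neg_mul_quadPoly hmi.isSymm hm (by positivity), lintegral_eq_tsum_unitCube,
    restrict_torusDomain, lintegral_prod _ ((measurable_theta τ).enorm.pow_const 2).aemeasurable,
    ← lintegral_tsum]
  swap
  · intro l
    refine (Continuous.measurable ?_).ennreal_ofReal.aemeasurable
    exact (continuous_const.mul (continuous_quadPoly.comp (by fun_prop))).neg.rexp
  refine lintegral_congr fun p => ?_
  set c : (Fin g → ℤ) → ℂ := fun l =>
    expTwoPiI ((quadPoly m n r (fun i => p i + l i) : ℂ) * τ) with hc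
  have hcs : Summable fun l => ‖c l‖ := by
    have := (hKC τ p 0).1
    simp only [norm_thetaTerm] at this
    simpa only [hc, norm_expTwoPiI_quadPoly_mul] using this
  have hcsq : ∀ l, ‖c l‖ ^ 2
      = Real.exp (-(4 * Real.pi * τ.im * quadPoly m n r fun i => p i + l i)) := by
    intro l
    rw [hc, norm_expTwoPiI_quadPoly_mul, sq, ← Real.exp_add]
    congr 1
    ring
  have hpars := integral_tsum_fourierChar_mul_conj hcs hcs ω ω
  have hnorm : ∀ q, ‖theta m n r τ (p, q)‖ₑ ^ 2
      = ENNReal.ofReal ((∑' l, c l * fourierChar (ω l) q)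
          * conj (∑' l, c l * fourierChar (ω l) q)).re := by
    intro q
    rw [theta_eq_mul_tsum hω, ← ofReal_norm, norm_mul, norm_expTwoPiI_ofReal, one_mul,
      ← ENNReal.ofReal_pow (norm_nonneg _), Complex.mul_conj, Complex.ofReal_re,
      Complex.normSq_eq_norm_sq]
  have hbd : ∀ q, ‖∑' l, c l * fourierChar (ω l) q‖ ≤ ∑' l, ‖c l‖ := by
    intro q
    refine (norm_tsum_le_tsum_norm (by simpa [norm_fourierChar] using hcs)).trans
      (le_of_eq (by simp [norm_fourierChar]))
  have hFm : Measurable fun q => ∑' l, c l * fourierChar (ω l) q :=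
    Measurable.tsum fun l => ((continuous_fourierChar _).measurable.const_mul _)
  have hint : Integrable (fun q => (∑' l, c l * fourierChar (ω l) q)
      * conj (∑' l, c l * fourierChar (ω l) q)) (volume.restrict (unitCube g)) := by
    refine Integrable.of_bound
      (hFm.mul (Complex.continuous_conj.measurable.comp hFm)).aestronglyMeasurable
      ((∑' l, ‖c l‖) * ∑' l, ‖c l‖) (Eventually.of_forall fun q => ?_)
    rw [norm_mul, RCLike.norm_conj]
    exact mul_le_mul (hbd q) (hbd q) (norm_nonneg _) (tsum_nonneg fun _ => norm_nonneg _)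
  simp_rw [hnorm]
  have hlint := ofReal_integral_eq_lintegral_ofReal hint.re
    (Eventually.of_forall fun q => by
      simp only [Pi.zero_apply, Complex.mul_conj, RCLike.re_eq_complex_re, Complex.ofReal_re]
      exact Complex.normSq_nonneg _)
  have hre := integral_re hint
  simp only [RCLike.re_eq_complex_re] at hre hlint
  rw [← hlint, hre, hpars]
  have hdiag : ∑' x : (Fin g → ℤ) × (Fin g → ℤ),
      c x.1 * conj (c x.2) * (if ω x.1 = ω x.2 then 1 else 0)
      = ((∑' l, ‖c l‖ ^ 2 : ℝ) : ℂ) := by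
    have hinj : Function.Injective fun l : Fin g → ℤ => (l, l) := fun a b h => congrArg Prod.fst h
    rw [← hinj.tsum_eq]
    · rw [Complex.ofReal_tsum]
      refine tsum_congr fun l => ?_
      simp [Complex.mul_conj, Complex.normSq_eq_norm_sq]
    · rintro ⟨a, b⟩ hab
      simp only [Function.mem_support, ne_eq, mul_eq_zero, not_or, ite_eq_right_iff] at hab
      have : ω a = ω b := by
        by_contra h
        exact hab.2 (fun h' => absurd h' h)
      exact ⟨a, by rw [thetaFreq_injective hm hω this]⟩
  rw [hdiag, Complex.ofReal_re, ENNReal.ofReal_tsum_of_nonneg (fun _ => sq_nonneg _)]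
  · simp_rw [hcsq]
  · refine Summable.of_nonneg_of_le (fun _ => sq_nonneg _) (fun l => ?_)
      (hcs.mul_left (∑' l, ‖c l‖))
    rw [sq]
    exact mul_le_mul_of_nonneg_right (hcs.le_tsum l fun _ _ => norm_nonneg _) (norm_nonneg _)

end Theta

/-! ### Pairing the Poincaré series with theta -/

section Pairing

open scoped ComplexConjugate ENNReal

variable {g : ℕ} {m : Matrix (Fin g) (Fin g) ℝ} {n : ℕ} {r : Fin g → ℤ}

theorem exists_norm_theta_le (hs : m.IsSymm) (hm : m.PosDef) (hD : 0 < quadMin m n r) :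
    ∃ K C : ℝ, 0 ≤ K ∧ 0 ≤ C ∧ ∀ (τ : ℍ) (x : (Fin g → ℝ) × (Fin g → ℝ)),
      ‖theta m n r τ x‖ ≤ K * Real.exp (C * τ.im) * (Real.sqrt τ.im ^ g)⁻¹ := by
  obtain ⟨K, C, hK, hC, h⟩ := exists_tsum_norm_thetaTerm_le hs hm hD
  exact ⟨K, C, hK, hC, fun τ x =>
    (norm_tsum_le_tsum_norm (h τ x.1 x.2).1).trans (h τ x.1 x.2).2⟩

/-- If `2r` lies in `ℤ^g 2m`, then theta is even. -/
theorem theta_neg_of_two_mul_mem (hs : m.IsSymm) {s : Fin g → ℤ}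
    (h : ∀ j, 2 * (r j : ℝ) = ∑ i, (s i : ℝ) * (2 * m i j)) (τ : ℍ)
    (x : (Fin g → ℝ) × (Fin g → ℝ)) : theta m n r τ (-x) = theta m n r τ x := by
  have hr : ∀ y : Fin g → ℝ, ∑ i, (r i : ℝ) * y i = (fun i => (s i : ℝ)) ⬝ᵥ m.mulVec y := by
    intro y
    rw [Matrix.dotProduct_mulVec]
    refine Finset.sum_congr rfl fun j _ => ?_
    congr 1
    have h2 : ∑ i, (s i : ℝ) * (2 * m i j) = 2 * ∑ i, (s i : ℝ) * m i j := by
      rw [Finset.mul_sum]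
      exact Finset.sum_congr rfl fun i _ => by ring
    have := h j
    rw [h2] at this
    simp only [Matrix.vecMul, dotProduct]
    linarith
  have hN : ∀ y : Fin g → ℝ, quadPoly m n r (fun i => -y i - s i) = quadPoly m n r y := by
    intro y
    have e : (fun i => -y i - (s i : ℝ)) = (-1 : ℝ) • (y + fun i => (s i : ℝ)) := by
      ext i; simp; ring
    rw [e]
    unfold quadPoly
    rw [hr, hr]
    simp only [Matrix.mulVec_smul, smul_dotProduct, dotProduct_smul, smul_eq_mul]
    rw [dotProduct_mulVec_add_self hs, Matrix.mulVec_add, dotProduct_add,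
      dotProduct_mulVec_comm hs y (fun i => (s i : ℝ))]
    ring
  have hterm : ∀ l : Fin g → ℤ, thetaTerm m n r l τ (-x).1 (-x).2
      = thetaTerm m n r (-l - s) τ x.1 x.2 := by
    intro l
    unfold thetaTerm
    congr 1
    have e1 := hN (fun i => (-x).1 i + (l i : ℝ))
    have e2 : (fun i => -((-x).1 i + (l i : ℝ)) - (s i : ℝ))
        = fun i => x.1 i + ((-l - s) i : ℤ) := by
      ext i; simp; ring
    rw [← e1, e2]
    have e3 := hr x.2
    have e3' : (∑ i, (r i : ℂ) * (x.2 i : ℂ))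
        = jacobiBilin m (fun i => (s i : ℂ)) (fun i => (x.2 i : ℂ)) := by
      rw [jacobiBilin_ofReal_intCast, ← e3]
      push_cast
      rfl
    have e4 : (∑ i, (r i : ℂ) * ((-x).2 i : ℂ)) = -∑ i, (r i : ℂ) * (x.2 i : ℂ) := by
      simp
    have e5 : ∀ y : Fin g → ℝ, (fun i => (((-y) i : ℝ) : ℂ)) = (-1 : ℂ) • fun i => (y i : ℂ) := by
      intro y; ext i; simp
    have e6 : (fun i => (((-l - s) i : ℤ) : ℂ))
        = (-1 : ℂ) • (fun i => (l i : ℂ)) + (-1 : ℂ) • fun i => (s i : ℂ) := by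
      ext i; simp; ring
    rw [e4, e3', e6]
    simp only [Prod.fst_neg, Prod.snd_neg, e5, jacobiBilin_add_left, jacobiBilin_smul_left,
      jacobiBilin_smul_right]
    ring
  have hinv : Function.Involutive fun l : Fin g → ℤ => -l - s := fun l => by simp
  unfold theta
  simp_rw [hterm]
  exact (hinv.toPerm).tsum_eq (fun l => thetaTerm m n r l τ x.1 x.2)

/-- If `2r` does not lie in `ℤ^g 2m`, then theta is orthogonal to its reflection. -/
theorem integral_theta_neg_mul_conj_eq_zero (hmi : IsHalfIntegral m) (hm : m.PosDef)
    (hD : 0 < quadMin m n r)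
    (h : ¬ ∃ s : Fin g → ℤ, ∀ j, 2 * (r j : ℝ) = ∑ i, (s i : ℝ) * (2 * m i j)) (τ : ℍ) :
    ∫ x in torusDomain g, theta m n r τ (-x) * conj (theta m n r τ x) = 0 := by
  obtain ⟨ω, hω⟩ := exists_thetaFreq hmi r
  obtain ⟨K, C, -, -, hKC⟩ := exists_tsum_norm_thetaTerm_le hmi.isSymm hm hD
  obtain ⟨K', C', hK', -, hKC'⟩ := exists_norm_theta_le hmi.isSymm hm hD
  have hcs : ∀ p : Fin g → ℝ, Summable fun l : Fin g → ℤ =>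
      ‖expTwoPiI ((quadPoly m n r (fun i => p i + l i) : ℂ) * τ)‖ := by
    intro p
    have := (hKC τ p 0).1
    simp only [norm_thetaTerm] at this
    simpa only [norm_expTwoPiI_quadPoly_mul] using this
  have hint : Integrable (fun x => theta m n r τ (-x) * conj (theta m n r τ x))
      (volume.restrict (torusDomain g)) := by
    refine Integrable.of_bound (((measurable_theta τ).comp measurable_neg).mul
      (Complex.continuous_conj.measurable.comp (measurable_theta τ))).aestronglyMeasurable
      ((K' * Real.exp (C' * τ.im) * (Real.sqrt τ.im ^ g)⁻¹)
        * (K' * Real.exp (C' * τ.im) * (Real.sqrt τ.im ^ g)⁻¹)) (Eventually.of_forall fun q => ?_)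
    rw [norm_mul, RCLike.norm_conj]
    exact mul_le_mul (hKC' _ _) (hKC' _ _) (norm_nonneg _) (by positivity)
  rw [restrict_torusDomain] at hint ⊢
  rw [integral_prod _ hint]
  refine integral_eq_zero_of_ae (Eventually.of_forall fun p => ?_)
  have hfc : ∀ ν (q : Fin g → ℝ), fourierChar ν (-q) = fourierChar (-ν) q := by
    intro ν q
    simp [fourierChar]
  have hpars := integral_tsum_fourierChar_mul_conj (hcs (-p)) (hcs p) (fun l => -ω l) ω
  have hz : ∀ x : (Fin g → ℤ) × (Fin g → ℤ), ¬ (-ω x.1 = ω x.2) := by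
    intro x hx
    refine h ⟨-x.1 - x.2, fun j => ?_⟩
    have h1 := hω x.1 j
    have h2 := hω x.2 j
    have h3 : -(ω x.1 j : ℝ) = ω x.2 j := by exact_mod_cast congrFun hx j
    simp only [Pi.sub_apply, Pi.neg_apply, Int.cast_sub, Int.cast_neg, sub_mul, neg_mul,
      Finset.sum_sub_distrib, Finset.sum_neg_distrib]
    linarith
  simp only [hz, if_false, mul_zero, tsum_zero] at hpars
  simp only [Pi.zero_apply]
  rw [← hpars]
  refine integral_congr_ae (Eventually.of_forall fun q => ?_)
  simp only [Prod.neg_mk]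
  rw [theta_eq_mul_tsum hω, theta_eq_mul_tsum hω, map_mul, Matrix.mulVec_neg, neg_dotProduct_neg]
  simp_rw [hfc]
  have hu : expTwoPiI ((p ⬝ᵥ m.mulVec q : ℝ) : ℂ) * conj (expTwoPiI ((p ⬝ᵥ m.mulVec q : ℝ) : ℂ))
      = 1 := by
    rw [Complex.mul_conj, Complex.normSq_eq_norm_sq, norm_expTwoPiI_ofReal]
    simp
  rw [mul_mul_mul_comm, hu, one_mul]

theorem integral_theta_mul_conj (τ : ℍ) :
    ∫ x in torusDomain g, theta m n r τ x * conj (theta m n r τ x)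
      = (((∫⁻ x in torusDomain g, ‖theta m n r τ x‖ₑ ^ 2).toReal : ℝ) : ℂ) := by
  have h1 : ∀ x, theta m n r τ x * conj (theta m n r τ x)
      = ((‖theta m n r τ x‖ ^ 2 : ℝ) : ℂ) := fun x => by
    rw [Complex.mul_conj, Complex.normSq_eq_norm_sq]
  simp_rw [h1]
  rw [integral_complex_ofReal, integral_eq_lintegral_of_nonneg_ae
    (Eventually.of_forall fun x => sq_nonneg _)
    ((measurable_theta τ).norm.pow_const 2).aestronglyMeasurable]
  refine congrArg (fun y : ℝ≥0∞ => ((y.toReal : ℝ) : ℂ)) (lintegral_congr fun x => ?_)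
  rw [ENNReal.ofReal_pow (norm_nonneg _), ofReal_norm]

/-- The contribution of `-1` to the pairing is non-negative. -/
theorem re_integral_theta_neg_mul_conj_nonneg (hmi : IsHalfIntegral m) (hm : m.PosDef)
    (hD : 0 < quadMin m n r) {k : ℤ}
    (hk : (∃ s : Fin g → ℤ, ∀ j, 2 * (r j : ℝ) = ∑ i, (s i : ℝ) * (2 * m i j)) → Even k) (τ : ℍ) :
    0 ≤ (∫ x in torusDomain g, (-1 : ℂ) ^ (-k) * theta m n r τ (-x)
      * conj (theta m n r τ x)).re := by
  simp_rw [mul_assoc]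
  rw [integral_const_mul]
  by_cases h : ∃ s : Fin g → ℤ, ∀ j, 2 * (r j : ℝ) = ∑ i, (s i : ℝ) * (2 * m i j)
  · obtain ⟨s, hs⟩ := h
    rw [(hk ⟨s, hs⟩).neg.neg_one_zpow, one_mul]
    simp_rw [theta_neg_of_two_mul_mem hmi.isSymm hs]
    rw [integral_theta_mul_conj, Complex.ofReal_re]
    exact ENNReal.toReal_nonneg
  · rw [integral_theta_neg_mul_conj_eq_zero hmi hm hD h, mul_zero, Complex.zero_re]

/-- The automorphy factor `cτ + d` of a bottom row. -/
noncomputable def rowDenom (s : Fin 2 → ℤ) (τ : ℍ) : ℂ := (s 0 : ℂ) * τ + s 1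

/-- The function `(e^{1 - 1/ρ} / ρ)^q`; for `q, ρ > 0` it is at most `1`, with equality only at
`ρ = 1`. -/
noncomputable def saddle (q ρ : ℝ) : ℝ := (ρ⁻¹ * Real.exp (1 - ρ⁻¹)) ^ q

theorem rowDenom_ne_zero (s : CoprimePair) (τ : ℍ) : rowDenom s.1 τ ≠ 0 := by
  intro h
  have him := congrArg Complex.im h
  have hre := congrArg Complex.re h
  simp [rowDenom] at him hre
  have h0 : s.1 0 = 0 := by
    rcases him with h | h
    · exact h
    · exact absurd h τ.im_pos.ne'
  rw [h0] at hre
  have h1 : s.1 1 = 0 := by simpa using hre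
  have := s.2
  rw [h0, h1] at this
  exact not_isCoprime_zero_zero this

theorem im_smul_eq_div_rowDenom {s : CoprimePair} {M : SL(2, ℤ)} (hM : ∀ i, M 1 i = s.1 i)
    (τ : ℍ) : (M • τ).im = τ.im / ‖rowDenom s.1 τ‖ ^ 2 := by
  have h : UpperHalfPlane.denom (M : GL (Fin 2) ℝ) τ = rowDenom s.1 τ := by
    simp [UpperHalfPlane.denom, rowDenom, ← hM]
  rw [ModularGroup.im_smul_eq_div_normSq, Complex.normSq_eq_norm_sq, ← h]

theorem norm_rowDenom_sq (s : Fin 2 → ℤ) (τ : ℍ) :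
    ‖rowDenom s τ‖ ^ 2 = ((s 0 : ℝ) * τ.re + s 1) ^ 2 + ((s 0 : ℝ) * τ.im) ^ 2 := by
  rw [← Complex.normSq_eq_norm_sq, Complex.normSq_apply]
  simp [rowDenom]
  ring

theorem one_le_abs_intCast {a : ℤ} (h : a ≠ 0) : (1 : ℝ) ≤ |(a : ℝ)| := by
  have := Int.one_le_abs h
  exact_mod_cast this

theorem div_norm_rowDenom_sq_le (s : CoprimePair) (τ : ℍ) :
    τ.im / ‖rowDenom s.1 τ‖ ^ 2 ≤ τ.im + τ.im⁻¹ := by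
  have hv := τ.im_pos
  rw [norm_rowDenom_sq]
  by_cases h0 : s.1 0 = 0
  · have hu : IsUnit (s.1 1) := by
      have := s.2
      rw [h0] at this
      exact isCoprime_zero_left.mp this
    have : ((s.1 1 : ℤ) : ℝ) ^ 2 = 1 := by
      rcases Int.isUnit_iff.mp hu with h | h <;> simp [h]
    rw [h0]
    simp [this, hv.le]
  · have h1 : (1 : ℝ) ≤ ((s.1 0 : ℤ) : ℝ) ^ 2 := by
      rw [← sq_abs]
      exact one_le_pow₀ (one_le_abs_intCast h0)
    have h2 : τ.im ^ 2 ≤ (((s.1 0 : ℤ) : ℝ) * τ.re + s.1 1) ^ 2 + (((s.1 0 : ℤ) : ℝ) * τ.im) ^ 2 := by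
      rw [mul_pow]
      nlinarith [sq_nonneg (((s.1 0 : ℤ) : ℝ) * τ.re + s.1 1), sq_nonneg τ.im]
    calc _ ≤ τ.im / τ.im ^ 2 := by gcongr
      _ = τ.im⁻¹ := by field_simp
      _ ≤ _ := by linarith

/-- The squared norm of `theta|M` in terms of the squared norm of theta. -/
theorem norm_ratio_eq {v D ρ : ℝ} {k : ℤ} (hv : 0 < v) (hρ : 0 < ρ)
    (hκ : 4 * Real.pi * v * D = k - (g : ℝ) / 2) :
    ρ ^ (-k) * (Real.exp (-(4 * Real.pi * (v / ρ) * D)) * (Real.sqrt (4 * Real.pi * (v / ρ)) ^ g)⁻¹)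
      = saddle ((k - (g : ℝ) / 2) / 2) ρ ^ 2
        * (Real.exp (-(4 * Real.pi * v * D)) * (Real.sqrt (4 * Real.pi * v) ^ g)⁻¹) := by
  have hb : 0 < ρ⁻¹ * Real.exp (1 - ρ⁻¹) := by positivity
  have h1 : saddle ((k - (g : ℝ) / 2) / 2) ρ ^ 2
      = ρ ^ (-k) * Real.sqrt ρ ^ g * Real.exp ((1 - ρ⁻¹) * (k - (g : ℝ) / 2)) := by
    rw [saddle, ← Real.rpow_natCast, ← Real.rpow_mul hb.le, Real.mul_rpow (by positivity)
      (Real.exp_pos _).le, ← Real.exp_mul, Real.inv_rpow hρ.le, ← Real.rpow_neg hρ.le,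
      Real.sqrt_eq_rpow, ← Real.rpow_natCast (ρ ^ (1 / 2 : ℝ)), ← Real.rpow_mul hρ.le,
      ← Real.rpow_intCast, ← Real.rpow_add hρ]
    congr 2
    · push_cast; ring
    · push_cast; ring
  have h2 : Real.sqrt (4 * Real.pi * (v / ρ)) = Real.sqrt (4 * Real.pi * v) / Real.sqrt ρ := by
    rw [← mul_div_assoc, Real.sqrt_div (by positivity)]
  have h3 : Real.exp (-(4 * Real.pi * (v / ρ) * D))
      = Real.exp ((1 - ρ⁻¹) * (k - (g : ℝ) / 2)) * Real.exp (-(4 * Real.pi * v * D)) := by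
    rw [← Real.exp_add, ← hκ]
    congr 1
    field_simp
    ring
  have hs : 0 < Real.sqrt ρ := Real.sqrt_pos.2 hρ
  have hs' : 0 < Real.sqrt (4 * Real.pi * v) := Real.sqrt_pos.2 (by positivity)
  rw [h1, h2, h3, div_pow, inv_div]
  field_simp

/-- The series over bottom rows pairs to zero with theta if the Poincaré series vanishes. Here
the `s`-th summand is the function `theta|M s` in torus coordinates. -/
theorem hasSum_pairing_zero (hmi : IsHalfIntegral m) (hm : m.PosDef) (hD : 0 < quadMin m n r)
    {k : ℤ} (hk : (g : ℤ) + 3 ≤ k) {M : CoprimePair → SL(2, ℤ)} (hM : ∀ s i, M s 1 i = s.1 i)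
    {τ : ℍ} (hP : ∀ z, jacobiPoincare k m n r τ z = 0) :
    HasSum (fun s => ∫ x in torusDomain g, rowDenom s.1 τ ^ (-k)
      * theta m n r (M s • τ) (torusSubst (M s) x) * conj (theta m n r τ x)) 0 := by
  obtain ⟨K, C, hK, hC, hKC⟩ := exists_tsum_norm_thetaTerm_le hmi.isSymm hm hD
  have hv := τ.im_pos
  set A : ℝ := K * Real.exp (C * (τ.im + τ.im⁻¹)) * (Real.sqrt τ.im ^ g)⁻¹ with hA
  have hA0 : 0 ≤ A := by positivity
  have hsv : 0 < Real.sqrt τ.im := Real.sqrt_pos.2 hv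
  -- `Im (M s • τ) = Im τ / |cτ + d|²`, so that theta at `M s • τ` is `O(|cτ + d|^g)`.
  have hbd : ∀ s : CoprimePair, ∀ p q, ∑' l, ‖thetaTerm m n r l (M s • τ) p q‖
      ≤ A * ‖rowDenom s.1 τ‖ ^ g := by
    intro s p q
    have hj : 0 < ‖rowDenom s.1 τ‖ := norm_pos_iff.2 (rowDenom_ne_zero s τ)
    refine (hKC (M s • τ) p q).2.trans ?_
    rw [im_smul_eq_div_rowDenom (hM s), Real.sqrt_div hv.le, Real.sqrt_sq hj.le, div_pow, inv_div,
      hA, mul_assoc _ (Real.sqrt τ.im ^ g)⁻¹, inv_mul_eq_div]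
    have := div_norm_rowDenom_sq_le s τ
    gcongr
  have heis : Summable fun s : CoprimePair => ‖rowDenom s.1 τ‖ ^ (-k) * (A * ‖rowDenom s.1 τ‖ ^ g) := by
    have := ((EisensteinSeries.summable_norm_eisSummand (k := k - g) (by omega) τ).subtype
      {s | IsCoprime (s 0) (s 1)}).mul_left A
    refine this.congr fun s => ?_
    have hj : ‖rowDenom s.1 τ‖ ≠ 0 := norm_ne_zero_iff.2 (rowDenom_ne_zero s τ)
    simp only [Function.comp, EisensteinSeries.eisSummand, norm_zpow]
    rw [mul_left_comm, ← zpow_natCast, ← zpow_add₀ hj]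
    congr 2
    ring
  have hzero : ∀ p q : Fin g → ℝ, ∑' s : CoprimePair, rowDenom s.1 τ ^ (-k)
      * theta m n r (M s • τ) (torusSubst (M s) (p, q)) = 0 := by
    intro p q
    have h1 := hP (fun i => (p i : ℂ) * τ + q i)
    rw [jacobiPoincare_eq_tsum hM k hmi] at h1
    have h2 := congrArg (fun w => expTwoPiI (jacobiBilin m (fun i => (p i : ℂ))
      (fun i => (p i : ℂ) * τ + q i)) * w) h1
    simp only [mul_zero] at h2
    rw [← tsum_mul_left] at h2
    simp_rw [expTwoPiI_mul_jacobiSlash k hmi] at h2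
    -- The double series converges absolutely, so it may be summed over the lattice first.
    rw [← h2, Summable.tsum_prod]
    · refine tsum_congr fun s => ?_
      have hth : theta m n r (M s • τ) (torusSubst (M s) (p, q))
          = ∑' l, thetaTerm m n r l (M s • τ)
            (fun i => ((M s 1 1 : ℤ) : ℝ) * p i - ((M s 1 0 : ℤ) : ℝ) * q i)
            (fun i => ((M s 0 0 : ℤ) : ℝ) * q i - ((M s 0 1 : ℤ) : ℝ) * p i) := rfl
      rw [hth, ← tsum_mul_left, rowDenom, ← hM, ← hM]
    · refine Summable.of_norm ?_
      rw [summable_prod_of_nonneg (fun _ => norm_nonneg _)]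
      simp only [norm_mul, hM, tsum_mul_left]
      refine ⟨fun s => (hKC _ _ _).1.mul_left _, ?_⟩
      refine Summable.of_nonneg_of_le
        (fun s => mul_nonneg (norm_nonneg _) (tsum_nonneg fun _ => norm_nonneg _))
        (fun s => ?_) heis
      rw [norm_zpow]
      exact mul_le_mul_of_nonneg_left (hbd s _ _) (zpow_nonneg (norm_nonneg _) _)
  have hth : ∀ s : CoprimePair, ∀ x, ‖theta m n r (M s • τ) x‖ ≤ A * ‖rowDenom s.1 τ‖ ^ g :=
    fun s x => (norm_tsum_le_tsum_norm (hKC _ _ _).1).trans (hbd s _ _)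
  obtain ⟨B, hB0, hB⟩ : ∃ B : ℝ, 0 ≤ B ∧ ∀ x, ‖theta m n r τ x‖ ≤ B :=
    ⟨_, by positivity, fun x => (norm_tsum_le_tsum_norm (hKC τ x.1 x.2).1).trans (hKC τ x.1 x.2).2⟩
  have hpt : ∀ s : CoprimePair, ∀ x, ‖rowDenom s.1 τ ^ (-k)
      * theta m n r (M s • τ) (torusSubst (M s) x) * conj (theta m n r τ x)‖
      ≤ ‖rowDenom s.1 τ‖ ^ (-k) * (A * ‖rowDenom s.1 τ‖ ^ g) * B := by
    intro s x
    rw [norm_mul, norm_mul, norm_zpow, RCLike.norm_conj]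
    have := hth s (torusSubst (M s) x)
    have := hB x
    gcongr
  have hint : ∀ s : CoprimePair, Integrable (fun x => rowDenom s.1 τ ^ (-k)
      * theta m n r (M s • τ) (torusSubst (M s) x) * conj (theta m n r τ x))
      (volume.restrict (torusDomain g)) := by
    intro s
    refine Integrable.of_bound (Measurable.aestronglyMeasurable ?_) _
      (Eventually.of_forall (hpt s))
    exact (((measurable_theta _).comp (continuous_torusSubst _).measurable).const_mul _).mul
      (Complex.continuous_conj.measurable.comp (measurable_theta τ))
  have hsum := hasSum_integral_of_summable_integral_norm hint ?_
  · rwa [integral_eq_zero_of_ae (Eventually.of_forall fun x => ?_)] at hsum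
    rw [tsum_mul_right, hzero x.1 x.2, zero_mul]
    rfl
  · refine Summable.of_nonneg_of_le (fun s => integral_nonneg fun _ => norm_nonneg _) (fun s => ?_)
      (heis.mul_right B)
    have := integral_mono (hint s).norm (integrable_const _) (hpt s)
    simpa using this

/-- Cauchy–Schwarz: the pairing of `theta|M` with theta is at most `saddle` times the squared
norm of theta, for `τ` at the height where `4π Im(τ) min N = k - g/2`. -/
theorem norm_pairing_le (hmi : IsHalfIntegral m) (hm : m.PosDef) (hD : 0 < quadMin m n r)
    {k : ℤ} {s : CoprimePair} {M : SL(2, ℤ)} (hM : ∀ i, M 1 i = s.1 i) {τ : ℍ}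
    (hτ : 4 * Real.pi * τ.im * quadMin m n r = k - (g : ℝ) / 2) :
    ‖∫ x in torusDomain g, rowDenom s.1 τ ^ (-k)
      * theta m n r (M • τ) (torusSubst M x) * conj (theta m n r τ x)‖ₑ
      ≤ ENNReal.ofReal (saddle ((k - (g : ℝ) / 2) / 2) (‖rowDenom s.1 τ‖ ^ 2))
        * ∫⁻ x in torusDomain g, ‖theta m n r τ x‖ₑ ^ 2 := by
  have hj : 0 < ‖rowDenom s.1 τ‖ := norm_pos_iff.2 (rowDenom_ne_zero s τ)
  have hsad : 0 ≤ saddle ((k - (g : ℝ) / 2) / 2) (‖rowDenom s.1 τ‖ ^ 2) := by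
    unfold saddle; positivity
  set a := saddle ((k - (g : ℝ) / 2) / 2) (‖rowDenom s.1 τ‖ ^ 2) with ha
  set R := ∫⁻ x in torusDomain g, ‖theta m n r τ x‖ₑ ^ 2 with hR
  set φ : (Fin g → ℝ) × (Fin g → ℝ) → ℂ := fun x => rowDenom s.1 τ ^ (-k)
      * theta m n r (M • τ) (torusSubst M x) with hφ
  have hφm : Measurable φ :=
    ((measurable_theta _).comp (continuous_torusSubst _).measurable).const_mul _
  have hφ2 : ∫⁻ x in torusDomain g, ‖φ x‖ₑ ^ 2 = ENNReal.ofReal a ^ 2 * R := by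
    have h1 : ∀ x, ‖φ x‖ₑ ^ 2 = ENNReal.ofReal ((‖rowDenom s.1 τ‖ ^ 2) ^ (-k))
        * ‖theta m n r (M • τ) (torusSubst M x)‖ₑ ^ 2 := by
      intro x
      have hz : (‖rowDenom s.1 τ‖ ^ (-k)) ^ 2 = (‖rowDenom s.1 τ‖ ^ 2) ^ (-k) := by
        rw [← zpow_natCast, ← zpow_natCast, ← zpow_mul, ← zpow_mul, mul_comm]
      rw [hφ, enorm_mul, mul_pow, ← ofReal_norm, norm_zpow, ← ENNReal.ofReal_pow (by positivity),
        hz]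
    simp_rw [h1]
    rw [lintegral_const_mul' _ _ ENNReal.ofReal_ne_top,
      setLIntegral_comp_torusSubst M (f := fun x => ‖theta m n r (M • τ) x‖ₑ ^ 2)
        ((measurable_theta _).enorm.pow_const 2)
        (fun l μ p q => by
          have := torusPeriodic_norm_theta (n := n) (r := r) hmi (M • τ) l μ p q
          simp only at this ⊢
          rw [this]),
      setLIntegral_enorm_theta_sq hmi hm hD, im_smul_eq_div_rowDenom hM, ← mul_assoc,
      ← ENNReal.ofReal_mul (by positivity), norm_ratio_eq τ.im_pos (by positivity) hτ, hR,
      setLIntegral_enorm_theta_sq hmi hm hD, ENNReal.ofReal_mul (by positivity), mul_assoc,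
      ENNReal.ofReal_pow hsad]
  calc ‖∫ x in torusDomain g, φ x * conj (theta m n r τ x)‖ₑ
      ≤ ∫⁻ x in torusDomain g, ‖φ x * conj (theta m n r τ x)‖ₑ := enorm_integral_le_lintegral_enorm _
    _ = ∫⁻ x in torusDomain g, ((fun x => ‖φ x‖ₑ) * fun x => ‖theta m n r τ x‖ₑ) x := by
        refine lintegral_congr fun x => ?_
        rw [enorm_mul, RCLike.enorm_conj]
        rfl
    _ ≤ (∫⁻ x in torusDomain g, ‖φ x‖ₑ ^ (2 : ℝ)) ^ (1 / 2 : ℝ)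
        * (∫⁻ x in torusDomain g, ‖theta m n r τ x‖ₑ ^ (2 : ℝ)) ^ (1 / 2 : ℝ) :=
        ENNReal.lintegral_mul_le_Lp_mul_Lq _ Real.HolderConjugate.two_two
          hφm.enorm.aemeasurable (measurable_theta τ).enorm.aemeasurable
    _ = ENNReal.ofReal a * R := by
        simp_rw [ENNReal.rpow_two]
        rw [hφ2, ENNReal.mul_rpow_of_nonneg _ _ (by norm_num), mul_assoc, ← ENNReal.rpow_two,
          ← ENNReal.rpow_mul, ← ENNReal.rpow_add_of_nonneg _ _ (by norm_num) (by norm_num)]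
        norm_num

/-- The Poincaré series does not vanish identically if, at some `τ` of the right height, the
contributions of the rows `(c, d)` with `c ≠ 0` to the pairing with theta are smaller than the
contribution of the identity. -/
theorem exists_jacobiPoincare_ne_zero (hmi : IsHalfIntegral m) (hm : m.PosDef)
    (hD : 0 < quadMin m n r) {k : ℤ} (hk : (g : ℤ) + 3 ≤ k)
    (hpar : (∃ s : Fin g → ℤ, ∀ j, 2 * (r j : ℝ) = ∑ i, (s i : ℝ) * (2 * m i j)) → Even k)
    {τ : ℍ} (hτ : 4 * Real.pi * τ.im * quadMin m n r = k - (g : ℝ) / 2)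
    (hE : ∑' s : CoprimePair, (if s.1 0 = 0 then 0 else ENNReal.ofReal
      (saddle ((k - (g : ℝ) / 2) / 2) (‖rowDenom s.1 τ‖ ^ 2))) < 1) :
    ∃ z, jacobiPoincare k m n r τ z ≠ 0 := by
  by_contra! hP
  obtain ⟨M, hM, hM1, hM2⟩ := exists_bottomRow_section
  have hsum := hasSum_pairing_zero hmi hm hD hk hM hP
  set X : CoprimePair → ℂ := fun s => ∫ x in torusDomain g, rowDenom s.1 τ ^ (-k)
      * theta m n r (M s • τ) (torusSubst (M s) x) * conj (theta m n r τ x) with hX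
  set R := ∫⁻ x in torusDomain g, ‖theta m n r τ x‖ₑ ^ 2 with hR
  have hv := τ.im_pos
  have hR0 : R ≠ 0 := by
    rw [hR, setLIntegral_enorm_theta_sq hmi hm hD]
    refine mul_ne_zero ?_ gaussConst_ne_zero
    rw [ne_eq, ENNReal.ofReal_eq_zero, not_le]
    have : 0 < Real.sqrt (4 * Real.pi * τ.im) := Real.sqrt_pos.2 (by positivity)
    positivity
  have hRtop : R ≠ ∞ := by
    rw [hR, setLIntegral_enorm_theta_sq hmi hm hD]
    exact ENNReal.mul_ne_top ENNReal.ofReal_ne_top (gaussConst_ne_top hm)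
  have hRpos : 0 < R.toReal := ENNReal.toReal_pos hR0 hRtop
  set b : CoprimePair → ℝ := fun s => if s.1 0 = 0 then 0 else
    saddle ((k - (g : ℝ) / 2) / 2) (‖rowDenom s.1 τ‖ ^ 2) with hb
  have hb0 : ∀ s, 0 ≤ b s := by
    intro s
    simp only [hb]
    split_ifs
    · exact le_rfl
    · unfold saddle; positivity
  have hE' : ∑' s, ENNReal.ofReal (b s) < 1 := by
    convert hE using 3 with s
    simp only [hb]
    split_ifs <;> simp
  have hbs : Summable b := by
    have := ENNReal.summable_toReal (hE'.trans_le le_top).ne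
    simpa [ENNReal.toReal_ofReal, hb0] using this
  have hb1 : ∑' s, b s < 1 := by
    rw [← ENNReal.ofReal_tsum_of_nonneg hb0 hbs] at hE'
    exact ENNReal.ofReal_lt_one.1 hE'
  set s1 : CoprimePair := ⟨![0, 1], isCoprime_zero_left.mpr isUnit_one⟩ with hs1
  have hX1 : (X s1).re = R.toReal := by
    have e : M s1 = 1 := hM1 s1 rfl rfl
    have e1 : rowDenom s1.1 τ = 1 := by simp [rowDenom, hs1]
    have e2 : ∀ x, torusSubst (g := g) 1 x = x := fun x => by
      ext i <;> simp [torusSubst]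
    simp only [hX, e, e1, e2, one_zpow, one_mul, one_smul]
    rw [integral_theta_mul_conj, Complex.ofReal_re]
  have hnn : ∀ s, 0 ≤ (X s).re + R.toReal * b s := by
    intro s
    by_cases h0 : s.1 0 = 0
    · have hbz : b s = 0 := by simp [hb, h0]
      rw [hbz, mul_zero, add_zero]
      have hu : IsUnit (s.1 1) := by
        have := s.2
        rw [h0] at this
        exact isCoprime_zero_left.mp this
      rcases Int.isUnit_iff.mp hu with h1 | h1
      · have : s = s1 := by
          ext i
          fin_cases i
          · exact h0
          · exact h1
        rw [this, hX1]
        exact hRpos.le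
      · have e : M s = -1 := hM2 s h0 h1
        have e1 : rowDenom s.1 τ = -1 := by simp [rowDenom, h0, h1]
        have e2 : ∀ x, torusSubst (g := g) (-1) x = -x := fun x => by
          ext i <;> simp [torusSubst]
        have e3 : (-1 : SL(2, ℤ)) • τ = τ := by
          rw [ModularGroup.SL_neg_smul, one_smul]
        simp only [hX, e, e1, e2, e3]
        exact re_integral_theta_neg_mul_conj_nonneg hmi hm hD hpar τ
    · have h1 := norm_pairing_le hmi hm hD (hM s) hτ
      have h2 : ‖X s‖ ≤ b s * R.toReal := by
        have h3 := ENNReal.toReal_mono (ENNReal.mul_ne_top ENNReal.ofReal_ne_top hRtop) h1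
        rw [toReal_enorm, ENNReal.toReal_mul, ENNReal.toReal_ofReal
          (by unfold saddle; positivity)] at h3
        simp only [hb, if_neg h0]
        exact h3
      have h3 := (Complex.abs_re_le_norm (X s)).trans h2
      linarith [neg_abs_le (X s).re]
  have hre : HasSum (fun s => (X s).re) 0 := by
    simpa using Complex.hasSum_re hsum
  -- Adding `R b s` makes all terms non-negative, while the total `R ∑ b` stays below the term `R`
  -- of the identity.
  have htot := hre.add (hbs.hasSum.mul_left R.toReal)
  have hle := htot.summable.le_tsum s1 fun s _ => hnn s
  rw [htot.tsum_eq, hX1, zero_add] at hle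
  have hbz : b s1 = 0 := by simp [hb, hs1]
  rw [hbz, mul_zero, add_zero] at hle
  nlinarith

end Pairing

/-! ### The rows with `c ≠ 0` -/

section Average

open scoped ENNReal

/-- Averaging a sum over residues: the mean over `u` of `∑ F(N u + d)` is `∫ F`. -/
theorem setLIntegral_tsum_mul_add {F : ℝ → ℝ≥0∞} (hF : Measurable F) (N : ℕ) [NeZero N] :
    ∫⁻ u in Set.Ico (0 : ℝ) 1, ∑' d : ℤ, F (N * u + d) = ∫⁻ t, F t := by
  have hN : (N : ℝ) ≠ 0 := Nat.cast_ne_zero.2 (NeZero.ne N)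
  have h1 : ∀ u : ℝ, ∑' d : ℤ, F (N * u + d)
      = ∑ j : Fin N, ∑' e : ℤ, F (N * (u + e) + (j : ℕ)) := by
    intro u
    rw [← (Int.divModEquiv N).symm.tsum_eq,
      ENNReal.tsum_prod' (f := fun x => F (N * u + ((Int.divModEquiv N).symm x : ℤ))),
      ENNReal.tsum_comm, tsum_fintype]
    refine Finset.sum_congr rfl fun j _ => tsum_congr fun e => ?_
    congr 1
    simp [Int.divModEquiv]
    ring
  have hunf : ∀ h : ℝ → ℝ≥0∞, ∫⁻ x, h x = ∑' e : ℤ, ∫⁻ x in Set.Ico (0 : ℝ) 1, h (x + e) := by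
    intro h
    have := lintegral_eq_tsum_of_floor (μ := (volume : Measure ℝ)) (fun e : ℤ => (e : ℝ))
      (fun x => ⌊x⌋) Int.measurable_floor (fun x l => Int.floor_add_intCast x l) h
    have hz : (fun x : ℝ => ⌊x⌋) ⁻¹' {0} = Set.Ico 0 1 := by
      ext x; simp
    rwa [hz] at this
  simp_rw [h1]
  rw [lintegral_finsetSum]
  swap
  · intro j _
    exact Measurable.tsum fun e => hF.comp (by fun_prop)
  have h2 : ∀ j : Fin N, ∫⁻ u in Set.Ico (0 : ℝ) 1, ∑' e : ℤ, F (N * (u + e) + (j : ℕ))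
      = ENNReal.ofReal |(N : ℝ)⁻¹| * ∫⁻ t, F t := by
    intro j
    have hm : ∀ e : ℤ, Measurable fun u : ℝ => F (N * (u + e) + (j : ℕ)) :=
      fun e => hF.comp (by fun_prop)
    have hm' : Measurable fun t : ℝ => F (t + (j : ℕ)) := hF.comp (by fun_prop)
    rw [lintegral_tsum fun e => (hm e).aemeasurable, ← hunf fun u => F (N * u + (j : ℕ)), ← lintegral_add_right_eq_self F ((j : ℕ) : ℝ),
      ← smul_eq_mul, ← lintegral_smul_measure, ← Real.map_volume_mul_left hN,
      lintegral_map hm' (by fun_prop)]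
  simp_rw [h2]
  rw [Finset.sum_const, Finset.card_univ, Fintype.card_fin, nsmul_eq_mul, ← mul_assoc,
    abs_of_nonneg (by positivity), ENNReal.ofReal_inv_of_pos (by positivity),
    ENNReal.ofReal_natCast, ENNReal.mul_inv_cancel (by exact_mod_cast NeZero.ne N) (by simp),
    one_mul]

theorem measurable_saddle (q : ℝ) : Measurable (saddle q) := by
  unfold saddle
  fun_prop

theorem setLIntegral_tsum_saddle (q v : ℝ) {c : ℤ} (hc : c ≠ 0) :
    ∫⁻ u in Set.Ico (0 : ℝ) 1, ∑' d : ℤ, ENNReal.ofReal (saddle q ((c * u + d) ^ 2 + (c * v) ^ 2))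
      = ∫⁻ t : ℝ, ENNReal.ofReal (saddle q (t ^ 2 + (c * v) ^ 2)) := by
  have hF : Measurable fun t : ℝ => ENNReal.ofReal (saddle q (t ^ 2 + (c * v) ^ 2)) :=
    ((measurable_saddle q).comp (by fun_prop)).ennreal_ofReal
  have : NeZero c.natAbs := ⟨Int.natAbs_ne_zero.2 hc⟩
  rw [← setLIntegral_tsum_mul_add hF c.natAbs]
  refine lintegral_congr fun u => ?_
  have habs : ((c.natAbs : ℕ) : ℝ) = |(c : ℝ)| := by
    rw [Nat.cast_natAbs]; simp
  rcases lt_or_gt_of_ne hc with h | h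
  · rw [← (Equiv.neg ℤ).tsum_eq]
    refine tsum_congr fun d => ?_
    rw [habs, abs_of_neg (by exact_mod_cast h)]
    congr 3
    simp
    ring
  · refine tsum_congr fun d => ?_
    rw [habs, abs_of_pos (by exact_mod_cast h)]

/-- Some `τ` of the given height does at least as well as the average over the real part. -/
theorem exists_tsum_saddle_le (q : ℝ) {v : ℝ} (hv : 0 < v) :
    ∃ τ : ℍ, τ.im = v ∧
      ∑' s : CoprimePair, (if s.1 0 = 0 then 0 else ENNReal.ofReal
        (saddle q (‖rowDenom s.1 τ‖ ^ 2)))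
      ≤ ∑' c : ℤ, if c = 0 then 0 else ∫⁻ t : ℝ, ENNReal.ofReal (saddle q (t ^ 2 + (c * v) ^ 2)) := by
  set f : ℝ → ℤ → ℤ → ℝ≥0∞ := fun u c d => if c = 0 then 0 else
    ENNReal.ofReal (saddle q ((c * u + d) ^ 2 + (c * v) ^ 2)) with hf
  have hfm : ∀ c d, Measurable fun u => f u c d := by
    intro c d
    simp only [hf]
    split_ifs
    · exact measurable_const
    · exact ((measurable_saddle q).comp (by fun_prop)).ennreal_ofReal
  have : IsProbabilityMeasure ((volume : Measure ℝ).restrict (Set.Ico 0 1)) := ⟨by simp⟩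
  obtain ⟨u, hu⟩ := exists_le_lintegral (μ := (volume : Measure ℝ).restrict (Set.Ico 0 1))
    (f := fun u => ∑' c, ∑' d, f u c d)
    (Measurable.tsum fun c => Measurable.tsum fun d => hfm c d).aemeasurable
  refine ⟨⟨⟨u, v⟩, hv⟩, rfl, ?_⟩
  have h1 : ∑' s : CoprimePair, (if s.1 0 = 0 then 0 else ENNReal.ofReal
        (saddle q (‖rowDenom s.1 ⟨⟨u, v⟩, hv⟩‖ ^ 2))) ≤ ∑' c, ∑' d, f u c d := by
    rw [← ENNReal.tsum_prod (f := fun c d => f u c d)]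
    have hinj : Function.Injective fun s : CoprimePair => (s.1 0, s.1 1) := by
      intro s s' h
      simp only [Prod.mk.injEq] at h
      ext i
      fin_cases i
      · exact h.1
      · exact h.2
    refine le_trans (le_of_eq ?_) (ENNReal.tsum_comp_le_tsum_of_injective hinj
      (fun x : ℤ × ℤ => f u x.1 x.2))
    refine tsum_congr fun s => ?_
    simp only [hf, norm_rowDenom_sq]
    rfl
  refine h1.trans (hu.trans (le_of_eq ?_))
  rw [lintegral_tsum fun c => (Measurable.tsum fun d => hfm c d).aemeasurable]
  refine tsum_congr fun c => ?_
  by_cases hc : c = 0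
  · simp [hf, hc]
  · simp only [hf, if_neg hc]
    exact setLIntegral_tsum_saddle q v hc

theorem saddle_base_le {ρ : ℝ} (hρ : 0 < ρ) :
    ρ⁻¹ * Real.exp (1 - ρ⁻¹) ≤ Real.exp (-(Real.sqrt ρ⁻¹ - 1) ^ 2) := by
  have hw : 0 < ρ⁻¹ := inv_pos.2 hρ
  have hlog : Real.log ρ⁻¹ ≤ 2 * (Real.sqrt ρ⁻¹ - 1) := by
    have h := Real.log_le_sub_one_of_pos (Real.sqrt_pos.2 hw)
    rw [Real.log_sqrt hw.le] at h
    linarith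
  calc ρ⁻¹ * Real.exp (1 - ρ⁻¹) = Real.exp (Real.log ρ⁻¹ + (1 - ρ⁻¹)) := by
        rw [Real.exp_add, Real.exp_log hw]
    _ ≤ _ := by
        refine Real.exp_le_exp.2 ?_
        nlinarith [Real.sq_sqrt hw.le]

theorem saddle_le_one {q ρ : ℝ} (hq : 0 ≤ q) (hρ : 0 < ρ) : saddle q ρ ≤ 1 := by
  refine Real.rpow_le_one (by positivity) ((saddle_base_le hρ).trans ?_) hq
  exact Real.exp_le_one_iff.2 (by nlinarith [sq_nonneg (Real.sqrt ρ⁻¹ - 1)])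

/-- Away from `ρ = 1` the function `saddle` is exponentially small, and decays like `ρ⁻²`. -/
theorem saddle_le_of_le_abs {q ρ δ : ℝ} (hq : 2 ≤ q) (hρ : 0 < ρ) (hδ : 0 ≤ δ)
    (h : δ ≤ |Real.sqrt ρ⁻¹ - 1|) :
    saddle q ρ ≤ Real.exp (-(δ ^ 2 * (q - 2))) * Real.exp 2 * (ρ ^ 2)⁻¹ := by
  have hb : 0 < ρ⁻¹ * Real.exp (1 - ρ⁻¹) := by positivity
  have h1 : ρ⁻¹ * Real.exp (1 - ρ⁻¹) ≤ Real.exp (-δ ^ 2) := by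
    refine (saddle_base_le hρ).trans (Real.exp_le_exp.2 ?_)
    have := pow_le_pow_left₀ hδ h 2
    rw [sq_abs] at this
    linarith
  have h2 : ρ⁻¹ * Real.exp (1 - ρ⁻¹) ≤ ρ⁻¹ * Real.exp 1 := by
    have : 0 < ρ⁻¹ := inv_pos.2 hρ
    gcongr
    linarith
  calc saddle q ρ = (ρ⁻¹ * Real.exp (1 - ρ⁻¹)) ^ (q - 2) * (ρ⁻¹ * Real.exp (1 - ρ⁻¹)) ^ 2 := by
        rw [saddle, ← Real.rpow_natCast, ← Real.rpow_add hb]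
        congr 1
        push_cast; ring
    _ ≤ Real.exp (-δ ^ 2) ^ (q - 2) * (ρ⁻¹ * Real.exp 1) ^ 2 := by
        gcongr
    _ = _ := by
        rw [← Real.exp_mul, mul_pow, ← Real.exp_nat_mul, inv_pow]
        push_cast
        rw [mul_one, neg_mul]
        ring

/-- The measure of the set where `t²` lies in an interval. -/
theorem volume_sq_mem_Icc_le {a b : ℝ} (hab : a ≤ b) :
    volume {t : ℝ | a ≤ t ^ 2 ∧ t ^ 2 ≤ b} ≤ ENNReal.ofReal (2 * Real.sqrt (b - a)) := by
  have hsub : {t : ℝ | a ≤ t ^ 2 ∧ t ^ 2 ≤ b}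
      ⊆ Set.Icc (-Real.sqrt b) (-Real.sqrt a) ∪ Set.Icc (Real.sqrt a) (Real.sqrt b) := by
    rintro t ⟨h1, h2⟩
    have h3 : Real.sqrt a ≤ |t| := by rw [← Real.sqrt_sq_eq_abs]; exact Real.sqrt_le_sqrt h1
    have h4 : |t| ≤ Real.sqrt b := by rw [← Real.sqrt_sq_eq_abs]; exact Real.sqrt_le_sqrt h2
    rcases abs_cases t with ⟨h, -⟩ | ⟨h, -⟩
    · right; rw [h] at h3 h4; exact ⟨h3, h4⟩
    · left; rw [h] at h3 h4; exact ⟨by linarith, by linarith⟩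
  have hs : Real.sqrt b - Real.sqrt a ≤ Real.sqrt (b - a) := by
    rcases le_or_gt a 0 with ha | ha
    · rw [Real.sqrt_eq_zero_of_nonpos ha, sub_zero]
      exact Real.sqrt_le_sqrt (by linarith)
    · rw [sub_le_iff_le_add]
      refine Real.sqrt_le_iff.2 ⟨by positivity, ?_⟩
      have e1 := Real.sq_sqrt ha.le
      have e2 := Real.sq_sqrt (sub_nonneg.2 hab)
      nlinarith [mul_nonneg (Real.sqrt_nonneg (b - a)) (Real.sqrt_nonneg a)]
  have hm : Real.sqrt a ≤ Real.sqrt b := Real.sqrt_le_sqrt hab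
  refine (measure_mono hsub).trans ((measure_union_le _ _).trans ?_)
  rw [Real.volume_Icc, Real.volume_Icc, ← ENNReal.ofReal_add (by linarith) (by linarith)]
  exact ENNReal.ofReal_le_ofReal (by linarith)

theorem lintegral_saddle_le {q δ v : ℝ} (hq : 2 ≤ q) (hδ : 0 < δ) (hδ' : δ ≤ 1 / 2) (hv : 0 < v)
    (hv1 : v ≤ 1) {c : ℤ} (hc : c ≠ 0) :
    ∫⁻ t : ℝ, ENNReal.ofReal (saddle q (t ^ 2 + (c * v) ^ 2))
      ≤ (if |(c : ℝ)| ≤ 2 / v then ENNReal.ofReal (2 * Real.sqrt (8 * δ)) else 0)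
        + ENNReal.ofReal (Real.exp (-(δ ^ 2 * (q - 2))) * Real.exp 2 * Real.pi * (v ^ 4)⁻¹
          * ((c : ℝ) ^ 2)⁻¹) := by
  have hc1 : (1 : ℝ) ≤ (c : ℝ) ^ 2 := by
    rw [← sq_abs]
    exact one_le_pow₀ (one_le_abs_intCast hc)
  set a : ℝ := ((1 + δ) ^ 2)⁻¹ - (c * v) ^ 2 with ha
  set b : ℝ := ((1 - δ) ^ 2)⁻¹ - (c * v) ^ 2 with hb
  have h1δ : 0 < 1 - δ := by linarith
  have hba : b - a ≤ 8 * δ := by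
    have : b - a = 4 * δ / ((1 - δ) ^ 2 * (1 + δ) ^ 2) := by
      rw [ha, hb]; field_simp; ring
    rw [this, div_le_iff₀ (by positivity)]
    have : (1 / 2 : ℝ) ≤ (1 - δ) ^ 2 * (1 + δ) ^ 2 := by
      have : (1 - δ) ^ 2 * (1 + δ) ^ 2 = (1 - δ ^ 2) ^ 2 := by ring
      rw [this]; nlinarith
    nlinarith
  have hab : a ≤ b := by
    have : ((1 + δ) ^ 2)⁻¹ ≤ ((1 - δ) ^ 2)⁻¹ := by gcongr; linarith
    linarith
  set S : Set ℝ := {t : ℝ | a ≤ t ^ 2 ∧ t ^ 2 ≤ b} with hS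
  have hSm : MeasurableSet S := by
    have h1 : MeasurableSet {t : ℝ | a ≤ t ^ 2} := measurableSet_le measurable_const (by fun_prop)
    have h2 : MeasurableSet {t : ℝ | t ^ 2 ≤ b} := measurableSet_le (by fun_prop) measurable_const
    exact h1.inter h2
  set E : ℝ := Real.exp (-(δ ^ 2 * (q - 2))) * Real.exp 2 with hE
  have hpt : ∀ t : ℝ, ENNReal.ofReal (saddle q (t ^ 2 + (c * v) ^ 2))
      ≤ S.indicator (fun _ => 1) t
        + ENNReal.ofReal (E * (v ^ 4)⁻¹ * ((c : ℝ) ^ 2)⁻¹ * (1 + t ^ 2)⁻¹) := by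
    intro t
    set ρ : ℝ := t ^ 2 + (c * v) ^ 2 with hρ'
    have hcv : 0 < (c * v : ℝ) ^ 2 := by rw [mul_pow]; positivity
    have hρ : 0 < ρ := by positivity
    by_cases ht : t ∈ S
    · rw [Set.indicator_of_mem ht]
      refine le_trans ?_ le_self_add
      exact ENNReal.ofReal_le_one.2 (saddle_le_one (by linarith) hρ)
    · rw [Set.indicator_of_notMem ht, zero_add]
      refine ENNReal.ofReal_le_ofReal ?_
      have hfar : δ ≤ |Real.sqrt ρ⁻¹ - 1| := by
        by_contra! hlt
        rw [abs_lt] at hlt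
        apply ht
        have hw : 0 < ρ⁻¹ := inv_pos.2 hρ
        have e := Real.sq_sqrt hw.le
        have e1 : ρ⁻¹ ≤ (1 + δ) ^ 2 := by
          rw [← e]
          exact pow_le_pow_left₀ (Real.sqrt_nonneg _) (by linarith) 2
        have e2 : (1 - δ) ^ 2 ≤ ρ⁻¹ := by
          rw [← e]
          exact pow_le_pow_left₀ h1δ.le (by linarith) 2
        have e3 := inv_anti₀ hw e1
        have e4 := inv_anti₀ (by positivity) e2
        rw [inv_inv] at e3 e4
        exact ⟨by linarith, by linarith⟩
      refine (saddle_le_of_le_abs hq hρ hδ.le hfar).trans ?_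
      have hlow : v ^ 4 * (c : ℝ) ^ 2 * (1 + t ^ 2) ≤ ρ ^ 2 := by
        have hv2 : v ^ 2 ≤ 1 := pow_le_one₀ hv.le hv1
        have e1 : v ^ 2 * (1 + t ^ 2) ≤ ρ := by
          rw [hρ', mul_pow]
          nlinarith [sq_nonneg t, sq_nonneg v]
        have e2 : v ^ 2 * (c : ℝ) ^ 2 ≤ ρ := by
          rw [hρ', mul_pow]
          nlinarith [sq_nonneg t]
        calc v ^ 4 * (c : ℝ) ^ 2 * (1 + t ^ 2) = (v ^ 2 * (1 + t ^ 2)) * (v ^ 2 * (c : ℝ) ^ 2) := by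
              ring
          _ ≤ ρ * ρ := by gcongr
          _ = ρ ^ 2 := by ring
      rw [mul_assoc E, mul_assoc E, ← mul_inv, ← mul_inv]
      gcongr
  refine (lintegral_mono hpt).trans ?_
  have hm2 : Measurable fun t : ℝ =>
      ENNReal.ofReal (E * (v ^ 4)⁻¹ * ((c : ℝ) ^ 2)⁻¹ * (1 + t ^ 2)⁻¹) := by fun_prop
  rw [lintegral_add_right _ hm2, lintegral_indicator hSm, setLIntegral_one]
  refine add_le_add ?_ (le_of_eq ?_)
  · split_ifs with hcv
    · refine (volume_sq_mem_Icc_le hab).trans (ENNReal.ofReal_le_ofReal ?_)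
      gcongr
    · -- for `|c| v > 2` the interval for `t ^ 2` lies below `0`
      have hSe : S = ∅ := by
        rw [Set.eq_empty_iff_forall_notMem]
        rintro t ⟨-, ht⟩
        rw [not_le, div_lt_iff₀ hv] at hcv
        have h4 : 4 < (c * v : ℝ) ^ 2 := by
          rw [← sq_abs, abs_mul, abs_of_pos hv]
          nlinarith
        have h5 : ((1 - δ) ^ 2)⁻¹ ≤ 4 := by
          rw [inv_le_comm₀ (by positivity) (by norm_num)]
          nlinarith
        nlinarith [sq_nonneg t]
      rw [hSe, measure_empty]
  · have hint : Integrable fun t : ℝ => E * (v ^ 4)⁻¹ * ((c : ℝ) ^ 2)⁻¹ * (1 + t ^ 2)⁻¹ :=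
      integrable_inv_one_add_sq.const_mul _
    rw [← ofReal_integral_eq_lintegral_ofReal hint (Eventually.of_forall fun t => by
      simp only [Pi.zero_apply]; positivity), integral_const_mul, integral_univ_inv_one_add_sq]
    congr 1
    ring

theorem tsum_lintegral_saddle_le {q δ v : ℝ} (hq : 2 ≤ q) (hδ : 0 < δ) (hδ' : δ ≤ 1 / 2)
    (hv : 0 < v) (hv1 : v ≤ 1) :
    (∑' c : ℤ, if c = 0 then 0 else ∫⁻ t : ℝ, ENNReal.ofReal (saddle q (t ^ 2 + (c * v) ^ 2)))
      ≤ ENNReal.ofReal (30 * Real.sqrt δ / v + Real.exp (-(δ ^ 2 * (q - 2))) * Real.exp 2 * Real.pi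
        * (v ^ 4)⁻¹ * ∑' c : ℤ, ((c : ℝ) ^ 2)⁻¹) := by
  have hZ : Summable fun c : ℤ => ((c : ℝ) ^ 2)⁻¹ := by
    simpa using (Real.summable_one_div_int_pow (p := 2)).2 (by norm_num)
  set E : ℝ := Real.exp (-(δ ^ 2 * (q - 2))) * Real.exp 2 * Real.pi * (v ^ 4)⁻¹ with hE
  have hE0 : 0 ≤ E := by positivity
  have hL : (2 : ℝ) ≤ 2 / v := by rw [le_div_iff₀ hv]; linarith
  have h1 : ∀ c : ℤ, (if c = 0 then 0 else
      ∫⁻ t : ℝ, ENNReal.ofReal (saddle q (t ^ 2 + (c * v) ^ 2)))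
      ≤ (if |(c : ℝ)| ≤ 2 / v then ENNReal.ofReal (2 * Real.sqrt (8 * δ)) else 0)
        + ENNReal.ofReal (E * ((c : ℝ) ^ 2)⁻¹) := by
    intro c
    split_ifs with h0
    · exact zero_le
    · exact zero_le
    · simpa [*] using lintegral_saddle_le hq hδ hδ' hv hv1 h0
    · simpa [*] using lintegral_saddle_le hq hδ hδ' hv hv1 h0
  refine (ENNReal.tsum_le_tsum h1).trans ?_
  -- The first summands are non-zero for at most `5 / v` values of `c`.
  rw [ENNReal.tsum_add, ENNReal.ofReal_add (by positivity)
    (mul_nonneg hE0 (tsum_nonneg fun _ => by positivity))]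
  refine add_le_add ?_ (le_of_eq ?_)
  · set n : ℕ := ⌊2 / v⌋₊ with hn
    have hmem : ∀ c : ℤ, |(c : ℝ)| ≤ 2 / v → c ∈ Finset.Icc (-(n : ℤ)) n := by
      intro c hc
      have hc' : ((c.natAbs : ℕ) : ℝ) ≤ 2 / v := by
        rw [Nat.cast_natAbs]; simpa using hc
      have := Nat.le_floor hc'
      rw [Finset.mem_Icc]
      omega
    rw [tsum_eq_sum (s := Finset.Icc (-(n : ℤ)) n)
      fun c hc => if_neg fun h => hc (hmem c h)]
    refine (Finset.sum_le_sum (g := fun _ => ENNReal.ofReal (2 * Real.sqrt (8 * δ)))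
      fun c _ => ?_).trans ?_
    · split_ifs
      · exact le_rfl
      · exact zero_le
    · rw [Finset.sum_const, Int.card_Icc, nsmul_eq_mul, ← ENNReal.ofReal_natCast,
        ← ENNReal.ofReal_mul (by positivity)]
      refine ENNReal.ofReal_le_ofReal ?_
      have hcard : (((n : ℤ) + 1 - -(n : ℤ)).toNat : ℝ) ≤ 5 / v := by
        have e1 : ((n : ℤ) + 1 - -(n : ℤ)).toNat = 2 * n + 1 := by omega
        have e2 : (n : ℝ) ≤ 2 / v := Nat.floor_le (by positivity)
        have e3 : (5 : ℝ) / v = 2 * (2 / v) + 1 / v := by ring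
        have e4 : 1 ≤ 1 / v := by rw [le_div_iff₀ hv]; linarith
        rw [e1, e3]
        push_cast
        linarith
      have hs8 : Real.sqrt (8 * δ) ≤ 3 * Real.sqrt δ := by
        rw [show (3 : ℝ) * Real.sqrt δ = Real.sqrt (9 * δ) by
          rw [Real.sqrt_mul (by norm_num), show (9 : ℝ) = 3 ^ 2 by norm_num,
            Real.sqrt_sq (by norm_num)]]
        exact Real.sqrt_le_sqrt (by linarith)
      calc _ ≤ 5 / v * (2 * (3 * Real.sqrt δ)) := by gcongr
        _ = _ := by ring
  · rw [← tsum_mul_left, ENNReal.ofReal_tsum_of_nonneg (fun c => by positivity) (hZ.mul_left _)]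

end Average

/-! ### The range of the parameters -/

section Asymptotics

theorem exp_neg_mul_log_div_log_log_le {B x : ℝ} (hB : 0 ≤ B) (hx : 1 < Real.log x) :
    Real.exp (-(B * Real.log x / Real.log (Real.log x)))
      ≤ Real.exp (-(B / 2 * Real.sqrt (Real.log x))) := by
  refine Real.exp_le_exp.2 (neg_le_neg ?_)
  have hy : 0 < Real.log x := by linarith
  have hll : 0 < Real.log (Real.log x) := Real.log_pos hx
  have h1 : Real.log (Real.log x) ≤ 2 * Real.sqrt (Real.log x) := by
    have h := Real.log_le_sub_one_of_pos (Real.sqrt_pos.2 hy)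
    rw [Real.log_sqrt hy.le] at h
    linarith
  rw [le_div_iff₀ hll]
  calc B / 2 * Real.sqrt (Real.log x) * Real.log (Real.log x)
      ≤ B / 2 * Real.sqrt (Real.log x) * (2 * Real.sqrt (Real.log x)) := by gcongr
    _ = B * (Real.sqrt (Real.log x) ^ 2) := by ring
    _ = B * Real.log x := by rw [Real.sq_sqrt hy.le]

/-- In the range `x ≤ T ≤ x^{1+α} exp(-B log x / log log x)` with `α ≤ 2/9`, the bound for the
rows with `c ≠ 0` is less than `1`. The choice `δ = q^{-4/9}` makes the first term
`O(T q^{-11/9})`, and the exponential in the second one `exp(-q^{1/9})`. -/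
theorem eventually_error_lt_one {B Z : ℝ} (hB : 0 < B) (hZ : 0 ≤ Z) :
    ∀ᶠ x : ℝ in atTop, ∀ α T : ℝ, α ≤ 2 / 9 → x ≤ T →
      T ≤ x ^ (1 + α) * Real.exp (-(B * Real.log x / Real.log (Real.log x))) →
      0 < x ∧ 2 ≤ (x + 1) / 2 ∧ (x + 1) / 2 / T ≤ 1 ∧ ∃ δ, 0 < δ ∧ δ ≤ 1 / 2 ∧
        30 * Real.sqrt δ / ((x + 1) / 2 / T) + Real.exp (-(δ ^ 2 * ((x + 1) / 2 - 2)))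
          * Real.exp 2 * Real.pi * (((x + 1) / 2 / T) ^ 4)⁻¹ * Z < 1 := by
  have hq : Tendsto (fun x : ℝ => (x + 1) / 2) atTop atTop :=
    (tendsto_atTop_add_const_right _ _ tendsto_id).atTop_div_const (by norm_num)
  have h1 : Tendsto (fun x : ℝ => 120 * Real.exp (-(B / 2 * Real.sqrt (Real.log x))))
      atTop (𝓝 (120 * 0)) := by
    refine Tendsto.const_mul _ (Real.tendsto_exp_neg_atTop_nhds_zero.comp ?_)
    exact (Real.tendsto_sqrt_atTop.comp Real.tendsto_log_atTop).const_mul_atTop (by positivity)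
  have h2 : Tendsto (fun x : ℝ => Real.exp 2 * Real.exp 2 * Real.pi * 256 * Z
      * ((((x + 1) / 2) ^ (1 / 9 : ℝ)) ^ 9 * Real.exp (-((x + 1) / 2) ^ (1 / 9 : ℝ))))
      atTop (𝓝 (Real.exp 2 * Real.exp 2 * Real.pi * 256 * Z * 0)) := by
    refine Tendsto.const_mul _ ((Real.tendsto_pow_mul_exp_neg_atTop_nhds_zero 9).comp ?_)
    exact (tendsto_rpow_atTop (by norm_num)).comp hq
  have h3 : Tendsto (fun x : ℝ => ((x + 1) / 2) ^ (-(4 / 9) : ℝ)) atTop (𝓝 0) :=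
    (tendsto_rpow_neg_atTop (by norm_num)).comp hq
  rw [mul_zero] at h1 h2
  filter_upwards [h1.eventually_lt_const (show (0 : ℝ) < 1 / 2 by norm_num),
    h2.eventually_lt_const (show (0 : ℝ) < 1 / 2 by norm_num),
    h3.eventually_le_const (show (0 : ℝ) < 1 / 2 by norm_num),
    eventually_ge_atTop 3, Real.tendsto_log_atTop.eventually_gt_atTop 1] with x e1 e2 e3 hx hlog
  intro α T hα hxT hT
  have hTpos : 0 < T := by linarith
  set q : ℝ := (x + 1) / 2 with hqdef
  have hq2 : 2 ≤ q := by rw [hqdef]; linarith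
  have hq0 : 0 < q := by linarith
  have hqT : q / T ≤ 1 := by rw [div_le_one hTpos, hqdef]; linarith
  refine ⟨by linarith, hq2, hqT, q ^ (-(4 / 9) : ℝ), by positivity, e3, ?_⟩
  set W := Real.exp (-(B * Real.log x / Real.log (Real.log x))) with hW
  have hW0 : 0 < W := Real.exp_pos _
  have hW1 : W ≤ Real.exp (-(B / 2 * Real.sqrt (Real.log x))) :=
    exp_neg_mul_log_div_log_log_le hB.le hlog
  have hW2 : W ≤ 1 := hW1.trans (Real.exp_le_one_iff.2 (by
    rw [neg_nonpos]; positivity))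
  have hTq : T / q ≤ 4 * W * q ^ (2 / 9 : ℝ) := by
    have a1 : x ^ (1 + α) ≤ x ^ (11 / 9 : ℝ) :=
      Real.rpow_le_rpow_of_exponent_le (by linarith) (by linarith)
    have a2 : x ^ (11 / 9 : ℝ) ≤ (2 * q) ^ (11 / 9 : ℝ) :=
      Real.rpow_le_rpow (by linarith) (by rw [hqdef]; linarith) (by norm_num)
    have a3 : (2 : ℝ) ^ (11 / 9 : ℝ) ≤ 4 := by
      calc (2 : ℝ) ^ (11 / 9 : ℝ) ≤ 2 ^ (2 : ℝ) :=
            Real.rpow_le_rpow_of_exponent_le (by norm_num) (by norm_num)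
        _ = 4 := by norm_num
    rw [Real.mul_rpow (by norm_num) hq0.le] at a2
    have a4 : q ^ (11 / 9 : ℝ) = q * q ^ (2 / 9 : ℝ) := by
      nth_rewrite 2 [← Real.rpow_one q]
      rw [← Real.rpow_add hq0]
      norm_num
    rw [div_le_iff₀ hq0]
    calc T ≤ x ^ (1 + α) * W := hT
      _ ≤ 4 * q ^ (11 / 9 : ℝ) * W := by
          refine mul_le_mul_of_nonneg_right ((a1.trans a2).trans ?_) hW0.le
          gcongr
      _ = _ := by rw [a4]; ring
  have hsqrt : Real.sqrt (q ^ (-(4 / 9) : ℝ)) * q ^ (2 / 9 : ℝ) = 1 := by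
    rw [Real.sqrt_eq_rpow, ← Real.rpow_mul hq0.le, ← Real.rpow_add hq0]
    norm_num
  have hfirst : 30 * Real.sqrt (q ^ (-(4 / 9) : ℝ)) / (q / T) ≤ 120 * W := by
    calc 30 * Real.sqrt (q ^ (-(4 / 9) : ℝ)) / (q / T)
        = 30 * Real.sqrt (q ^ (-(4 / 9) : ℝ)) * (T / q) := by rw [div_div_eq_mul_div]; ring
      _ ≤ 30 * Real.sqrt (q ^ (-(4 / 9) : ℝ)) * (4 * W * q ^ (2 / 9 : ℝ)) := by gcongr
      _ = 120 * W * (Real.sqrt (q ^ (-(4 / 9) : ℝ)) * q ^ (2 / 9 : ℝ)) := by ring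
      _ = 120 * W := by rw [hsqrt, mul_one]
  have hpow : ((q / T) ^ 4)⁻¹ ≤ 256 * q := by
    rw [← inv_pow, inv_div]
    calc (T / q) ^ 4 ≤ (4 * 1 * q ^ (2 / 9 : ℝ)) ^ 4 := by
          have : 4 * W * q ^ (2 / 9 : ℝ) ≤ 4 * 1 * q ^ (2 / 9 : ℝ) := by gcongr
          exact pow_le_pow_left₀ (by positivity) (hTq.trans this) 4
      _ = 256 * q ^ (8 / 9 : ℝ) := by
          rw [mul_pow, ← Real.rpow_natCast (q ^ (2 / 9 : ℝ)), ← Real.rpow_mul hq0.le]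
          norm_num
      _ ≤ 256 * q := by
          have : q ^ (8 / 9 : ℝ) ≤ q ^ (1 : ℝ) :=
            Real.rpow_le_rpow_of_exponent_le (by linarith) (by norm_num)
          rw [Real.rpow_one] at this
          linarith
  have hexp : Real.exp (-((q ^ (-(4 / 9) : ℝ)) ^ 2 * (q - 2)))
      ≤ Real.exp 2 * Real.exp (-q ^ (1 / 9 : ℝ)) := by
    rw [← Real.exp_add]
    refine Real.exp_le_exp.2 ?_
    have b1 : (q ^ (-(4 / 9) : ℝ)) ^ 2 * q = q ^ (1 / 9 : ℝ) := by
      rw [← Real.rpow_natCast, ← Real.rpow_mul hq0.le]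
      nth_rewrite 2 [← Real.rpow_one q]
      rw [← Real.rpow_add hq0]
      norm_num
    have b2 : (q ^ (-(4 / 9) : ℝ)) ^ 2 ≤ 1 := pow_le_one₀ (by positivity) (by linarith)
    linarith
  have hq9 : (q ^ (1 / 9 : ℝ)) ^ 9 = q := by
    rw [← Real.rpow_natCast, ← Real.rpow_mul hq0.le]
    norm_num
  have hsecond : Real.exp (-((q ^ (-(4 / 9) : ℝ)) ^ 2 * (q - 2))) * Real.exp 2 * Real.pi
      * ((q / T) ^ 4)⁻¹ * Z ≤ Real.exp 2 * Real.exp 2 * Real.pi * 256 * Z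
        * ((q ^ (1 / 9 : ℝ)) ^ 9 * Real.exp (-q ^ (1 / 9 : ℝ))) := by
    calc _ ≤ Real.exp 2 * Real.exp (-q ^ (1 / 9 : ℝ)) * Real.exp 2 * Real.pi * (256 * q) * Z := by
          gcongr
      _ = _ := by rw [hq9]; ring
  linarith

theorem jacobiAlpha_le {g : ℕ} (hg : 1 ≤ g) : jacobiAlpha g ≤ 2 / 9 := by
  have h1 : (1 : ℝ) ≤ g := by exact_mod_cast hg
  unfold jacobiAlpha
  split_ifs with h
  · rw [div_le_div_iff₀ (by positivity) (by norm_num)]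
    linarith
  · have h5 : (5 : ℝ) ≤ g := by exact_mod_cast (by omega : 5 ≤ g)
    rw [div_le_div_iff₀ (by positivity) (by norm_num)]
    linarith

theorem pi_mul_jacobiDisc_div_det {g : ℕ} {m : Matrix (Fin g) (Fin g) ℝ} (hm : m.PosDef) (n : ℕ)
    (r : Fin g → ℤ) :
    Real.pi * jacobiDisc m n r / ((2 : ℝ) • m).det = 2 * Real.pi * quadMin m n r := by
  have hdet : 0 < ((2 : ℝ) • m).det := by
    rw [Matrix.det_smul]
    exact mul_pos (by positivity) hm.det_pos
  have hinv : Invertible ((2 : ℝ) • m) := Matrix.invertibleOfIsUnitDet _ hdet.ne'.isUnit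
  have h2 : ((2 : ℝ) • m)⁻¹ = (2⁻¹ : ℝ) • m⁻¹ := by
    refine Matrix.inv_eq_right_inv ?_
    rw [Matrix.smul_mul, Matrix.mul_smul, smul_smul,
      Matrix.mul_nonsing_inv _ hm.det_pos.ne'.isUnit]
    norm_num
  have h3 : jacobiDisc m n r = ((2 : ℝ) • m).det * (2 * quadMin m n r) := by
    unfold jacobiDisc
    rw [Matrix.det_fromBlocks₂₂, Matrix.invOf_eq_nonsing_inv, h2]
    congr 1
    rw [Matrix.det_unique, quadMin]
    simp only [Matrix.sub_apply, Matrix.mul_apply, Matrix.of_apply, Matrix.smul_apply,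
      smul_eq_mul, dotProduct, Matrix.mulVec, Finset.mul_sum, Finset.sum_mul, mul_sub, Finset.sum_div]
    congr 1
    rw [Finset.sum_comm]
    exact Finset.sum_congr rfl fun i _ => Finset.sum_congr rfl fun j _ => by ring
  rw [h3]
  field_simp

end Asymptotics

end JacobiPoincare

open JacobiPoincare

theorem mainTheorem1 :
    ∃ B : ℝ, 3 * Real.log 2 < B ∧
      ∀ g : ℕ, 1 ≤ g → ∃ k₀ : ℤ, ∀ k : ℤ, k₀ ≤ k →
        ∀ (m : Matrix (Fin g) (Fin g) ℝ) (n : ℕ) (r : Fin g → ℤ) (k' : ℝ),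
          IsHalfIntegral m → m.PosDef →
          (fun i => (r i : ℝ)) ⬝ᵥ (m⁻¹.mulVec fun i => (r i : ℝ)) < 4 * (n : ℝ) →
          ((∃ s : Fin g → ℤ, ∀ j, 2 * (r j : ℝ) = ∑ i, (s i : ℝ) * (2 * m i j)) → Even k) →
          k' = (k : ℝ) - (g : ℝ) / 2 - 1 →
          k' ≤ Real.pi * jacobiDisc m n r / ((2 : ℝ) • m).det →
          Real.pi * jacobiDisc m n r / ((2 : ℝ) • m).det ≤
            k' ^ (1 + jacobiAlpha g) * Real.exp (-(B * Real.log k' / Real.log (Real.log k'))) →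
          ∃ (τ : ℍ) (z : Fin g → ℂ), jacobiPoincare k m n r τ z ≠ 0 := by
  have hlog2 : 0 < Real.log 2 := Real.log_pos one_lt_two
  -- The argument works for every positive `B`.
  refine ⟨3 * Real.log 2 + 1, by linarith, fun g hg => ?_⟩
  obtain ⟨x₀, hx₀⟩ := Filter.eventually_atTop.1 (eventually_error_lt_one
    (B := 3 * Real.log 2 + 1) (Z := ∑' c : ℤ, ((c : ℝ) ^ 2)⁻¹) (by linarith)
    (tsum_nonneg fun _ => by positivity))
  -- This `k₀` ensures both `k' ≥ x₀` and the absolute convergence for `k ≥ g + 3`.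
  refine ⟨max ⌈x₀⌉ 0 + g + 3, fun k hk m n r k' hmi hm hD hpar hk' hlow hup => ?_⟩
  have hk0 : (g : ℤ) + 3 ≤ k := by have := le_max_right ⌈x₀⌉ 0; linarith
  have hkx : x₀ ≤ k' := by
    have h1 : x₀ ≤ (max ⌈x₀⌉ 0 : ℤ) := (Int.le_ceil x₀).trans (by exact_mod_cast le_max_left _ _)
    have h2 : ((max ⌈x₀⌉ 0 : ℤ) : ℝ) + g + 3 ≤ k := by exact_mod_cast hk
    have h3 : (0 : ℝ) ≤ g := Nat.cast_nonneg g
    rw [hk']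
    linarith
  have hmin := quadMin_pos hD
  rw [pi_mul_jacobiDisc_div_det hm] at hlow hup
  obtain ⟨hk'pos, hq2, hv1, δ, hδ, hδ', herr⟩ :=
    hx₀ k' hkx _ _ (jacobiAlpha_le hg) hlow hup
  have hq : (k' + 1) / 2 = ((k : ℝ) - (g : ℝ) / 2) / 2 := by rw [hk']; ring
  set T : ℝ := 2 * Real.pi * quadMin m n r with hT
  have hTpos : 0 < T := by positivity
  have hv : 0 < (k' + 1) / 2 / T := by positivity
  obtain ⟨τ, hτ, hle⟩ := exists_tsum_saddle_le ((k' + 1) / 2) hv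
  have hE := (hle.trans (tsum_lintegral_saddle_le hq2 hδ hδ' hv hv1)).trans_lt
    (ENNReal.ofReal_lt_one.2 herr)
  rw [hq] at hE
  refine ⟨τ, exists_jacobiPoincare_ne_zero hmi hm hmin hk0 hpar ?_ hE⟩
  rw [hτ, hk']
  have : 4 * Real.pi * (((k : ℝ) - (g : ℝ) / 2 - 1 + 1) / 2 / T) * quadMin m n r
      = ((k : ℝ) - (g : ℝ) / 2) * (2 * Real.pi * quadMin m n r) / T := by ring
  rw [this, ← hT, mul_div_assoc, div_self hTpos.ne', mul_one]
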